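/- Let $k$ be a field of characteristic $2$, let $V_4 = C_2\oplus C_2$ be the Klein four group and let $kV_4$ be its group algebra. For a $kV_4$-module $X$, let $\Omega X$ be the kernel of a projective cover $P\to X$ and $\Omega^{-1}X$ the cokernel of an injective hull $X\to I$ (both well defined up to isomorphism); for $l\ge 1$ let $\Omega^{l}$ and $\Omega^{-l}$ denote the $l$-fold iterates, applied below to the trivial one-dimensional module $k$. Let $M$ be a projective-free $kV_4$-module, i.e. one with no nonzero projective direct summand. Then: 1. If $l$ is the smallest positive integer such that $\Omega^l(k)$ is isomorphic to a submodule of $M$, then $\Omega^l(k)$ is isomorphic to a direct summand of $M$. 2. If $l$ is the smallest positive integer such that $\Omega^{-l}(k)$ is isomorphic to a quotient module of $M$, then $\Omega^{-l}(k)$ is isomorphic to a direct summand of $M$. -/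

import Mathlib

universe u v w

/-- `f : P → X` is a projective cover: `P` is projective, `f` is surjective and its kernel is
superfluous (small) in `P`. -/
structure IsProjectiveCover {A : Type u} [Ring A] {P : Type v} {X : Type w}
    [AddCommGroup P] [Module A P] [AddCommGroup X] [Module A X] (f : P →ₗ[A] X) : Prop where
  projective : Module.Projective A P
  surjective : Function.Surjective f
  superfluous : ∀ N : Submodule A P, N ⊔ LinearMap.ker f = ⊤ → N = ⊤

/-- `f : X → I` is an injective hull: `I` is injective, `f` is injective and its image is
essential (large) in `I`. -/
structure IsInjectiveHull {A : Type u} [Ring A] {X : Type w} {I : Type v}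
    [AddCommGroup X] [Module A X] [AddCommGroup I] [Module A I] (f : X →ₗ[A] I) : Prop where
  injective_module : Module.Injective A I
  injective : Function.Injective f
  essential : ∀ N : Submodule A I, N ⊓ LinearMap.range f = ⊥ → N = ⊥

/-- `Y ≅ Ω X`: `Y` is isomorphic to the kernel of a projective cover of `X`. -/
def IsSyzygy {A : Type u} [Ring A] (X Y : ModuleCat.{u} A) : Prop :=
  ∃ (P : ModuleCat.{u} A) (f : P →ₗ[A] X),
    IsProjectiveCover f ∧ Nonempty (Y ≃ₗ[A] LinearMap.ker f)

/-- `Y ≅ Ω⁻¹ X`: `Y` is isomorphic to the cokernel of an injective hull of `X`. -/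
def IsCosyzygy {A : Type u} [Ring A] (X Y : ModuleCat.{u} A) : Prop :=
  ∃ (I : ModuleCat.{u} A) (f : X →ₗ[A] I),
    IsInjectiveHull f ∧ Nonempty (Y ≃ₗ[A] (I ⧸ LinearMap.range f))

/-- `IsNthSyzygy X n Y` means `Y ≅ Ωⁿ X`. -/
def IsNthSyzygy {A : Type u} [Ring A] (X : ModuleCat.{u} A) : ℕ → ModuleCat.{u} A → Prop
  | 0, Y => Nonempty (X ≃ₗ[A] Y)
  | n + 1, Y => ∃ Z : ModuleCat.{u} A, IsNthSyzygy X n Z ∧ IsSyzygy Z Y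

/-- `IsNthCosyzygy X n Y` means `Y ≅ Ω⁻ⁿ X`. -/
def IsNthCosyzygy {A : Type u} [Ring A] (X : ModuleCat.{u} A) : ℕ → ModuleCat.{u} A → Prop
  | 0, Y => Nonempty (X ≃ₗ[A] Y)
  | n + 1, Y => ∃ Z : ModuleCat.{u} A, IsNthCosyzygy X n Z ∧ IsCosyzygy Z Y

/-- The trivial one-dimensional representation `k` of `G`, as a module over the group algebra. -/
noncomputable abbrev trivialModule (k : Type u) [Field k] (G : Type) [Group G] :
    ModuleCat.{u} (MonoidAlgebra k G) :=
  ModuleCat.of (MonoidAlgebra k G) (Representation.trivial k G k).asModule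

/-- `M` has no nonzero projective direct summand. -/
def IsProjectiveFree (A : Type u) [Ring A] (M : Type v) [AddCommGroup M] [Module A M] : Prop :=
  ∀ P Q : Submodule A M, IsCompl P Q → Module.Projective A P → P = ⊥

/-- `N` is isomorphic to a submodule of `M`. -/
def IsIsoToSubmodule (A : Type u) [Ring A] (N : Type w) [AddCommGroup N] [Module A N]
    (M : Type v) [AddCommGroup M] [Module A M] : Prop :=
  ∃ S : Submodule A M, Nonempty (N ≃ₗ[A] S)

/-- `N` is isomorphic to a quotient module of `M`. -/
def IsIsoToQuotient (A : Type u) [Ring A] (N : Type w) [AddCommGroup N] [Module A N]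
    (M : Type v) [AddCommGroup M] [Module A M] : Prop :=
  ∃ S : Submodule A M, Nonempty (N ≃ₗ[A] (M ⧸ S))

/-- `N` is isomorphic to a direct summand of `M`. -/
def IsIsoToSummand (A : Type u) [Ring A] (N : Type w) [AddCommGroup N] [Module A N]
    (M : Type v) [AddCommGroup M] [Module A M] : Prop :=
  ∃ P Q : Submodule A M, IsCompl P Q ∧ Nonempty (N ≃ₗ[A] P)

section PencilChains

variable {k : Type*} [Field k] {V W : Type*} [AddCommGroup V] [Module k V]
  [AddCommGroup W] [Module k W]

/-- The coefficients `a 0, …, a n` of a polynomial of degree at most `n` in the kernel of the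
pencil `y - t x`. -/
structure IsPencilChain (x y : V →ₗ[k] W) (n : ℕ) (a : ℕ → V) : Prop where
  map_zero : y (a 0) = 0
  map_succ : ∀ i, x (a i) = y (a (i + 1))
  eq_zero : ∀ i, n < i → a i = 0

theorem IsPencilChain.map_last {x y : V →ₗ[k] W} {n : ℕ} {a : ℕ → V}
    (ha : IsPencilChain x y n a) {i : ℕ} (hi : n ≤ i) : x (a i) = 0 := by
  rw [ha.map_succ, ha.eq_zero _ (by omega), LinearMap.map_zero]

theorem exists_mem_span_of_not_linearIndependent {n : ℕ} {v : ℕ → W}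
    (h : ¬ LinearIndependent k (fun i : Fin n => v i)) :
    ∃ m < n, v m ∈ Submodule.span k (v '' {i | i < m}) := by
  induction n with
  | zero => exact absurd linearIndependent_empty_type h
  | succ n ih =>
    by_cases hn : LinearIndependent k (fun i : Fin n => v i)
    · rw [linearIndependent_finSucc'] at h
      refine ⟨n, n.lt_succ_self, ?_⟩
      by_contra hc
      refine h ⟨hn, ?_⟩
      rw [Fin.val_last]
      convert hc using 3
      ext w
      simp only [Set.mem_range, Set.mem_image, Set.mem_ofPred_eq]
      constructor
      · rintro ⟨i, rfl⟩
        exact ⟨i, i.2, by simp [Fin.init]⟩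
      · rintro ⟨i, hi, rfl⟩
        exact ⟨⟨i, hi⟩, by simp [Fin.init]⟩
    · obtain ⟨m, hm, h⟩ := ih hn
      exact ⟨m, by omega, h⟩

/-- A combination of the earlier vectors `x (a i)` can be subtracted from the `m`-th term of a
chain without changing its leading term. -/
theorem exists_shift_combination {x y : V →ₗ[k] W} {a : ℕ → V} (h0 : y (a 0) = 0)
    (hs : ∀ i, x (a i) = y (a (i + 1))) {m : ℕ} {w : W}
    (hw : w ∈ Submodule.span k ((fun i => x (a i)) '' {i | i < m})) :
    ∃ e : ℕ → V, e 0 = 0 ∧ (∀ i, x (e i) = y (e (i + 1))) ∧ x (e m) = w := by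
  induction hw using Submodule.span_induction with
  | mem w hw =>
    obtain ⟨i, hi, rfl⟩ := hw
    simp only [Set.mem_ofPred_eq] at hi
    refine ⟨fun t => if t < m - i then 0 else a (t - (m - i)), ?_, ?_, ?_⟩
    · simp only
      rw [if_pos (by omega)]
    · intro t
      simp only
      by_cases h1 : t + 1 < m - i
      · rw [if_pos (by omega), if_pos h1, map_zero, map_zero]
      · rw [if_neg h1]
        by_cases h2 : t < m - i
        · rw [if_pos h2, show t + 1 - (m - i) = 0 by omega, h0, map_zero]
        · rw [if_neg h2, hs, show t - (m - i) + 1 = t + 1 - (m - i) by omega]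
    · simp only
      rw [if_neg (by omega), show m - (m - i) = i by omega]
  | zero => exact ⟨0, by simp⟩
  | add w₁ w₂ _ _ h₁ h₂ =>
    obtain ⟨e₁, a₁, b₁, c₁⟩ := h₁
    obtain ⟨e₂, a₂, b₂, c₂⟩ := h₂
    exact ⟨e₁ + e₂, by simp [a₁, a₂], by simp [b₁, b₂], by simp [c₁, c₂]⟩
  | smul c w _ h =>
    obtain ⟨e, a, b, d⟩ := h
    exact ⟨c • e, by simp [a], by simp [b], by simp [d]⟩

/-- A kernel polynomial of minimal degree has linearly independent values. -/
theorem IsPencilChain.exists_linearIndependent {x y : V →ₗ[k] W} {n : ℕ} {a : ℕ → V}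
    (ha : IsPencilChain x y n a) (hx : x (a 0) ≠ 0) :
    ∃ m, 0 < m ∧ m ≤ n ∧ ∃ a' : ℕ → V, IsPencilChain x y m a' ∧
      LinearIndependent k (fun i : Fin m => x (a' i)) := by
  induction n using Nat.strong_induction_on generalizing a with
  | _ n ih =>
    by_cases hli : LinearIndependent k (fun i : Fin n => x (a i))
    · refine ⟨n, ?_, le_rfl, a, ha, hli⟩
      by_contra h
      exact hx (ha.map_last (by omega))
    · obtain ⟨m, hm, hspan⟩ := exists_mem_span_of_not_linearIndependent
        (v := fun i => x (a i)) hli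
      obtain ⟨e, he0, hes, hem⟩ := exists_shift_combination ha.map_zero ha.map_succ hspan
      have hc : IsPencilChain x y m (fun i => if i ≤ m then a i - e i else 0) := by
        refine ⟨by simp [he0, ha.map_zero], fun i => ?_, fun i hi => if_neg (by omega)⟩
        rcases lt_trichotomy i m with h | rfl | h
        · rw [if_pos h.le, if_pos (by omega), map_sub, map_sub, ha.map_succ, hes]
        · simp [hem]
        · simp [show ¬ i ≤ m by omega, show ¬ i + 1 ≤ m by omega]
      obtain ⟨p, hp, hpm, h⟩ := ih m hm hc (by simpa [he0] using hx)
      exact ⟨p, hp, by omega, h⟩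

/-- The initial values `w = y (v 0)` of the solutions of
`x (v i) = y (v (i + 1))`, `x (v (n - 1)) = 0`. -/
def pencilReach (x y : V →ₗ[k] W) : ℕ → Submodule k W
  | 0 => ⊥
  | n + 1 => ((pencilReach x y n).comap x).map y

theorem exists_of_mem_pencilReach {x y : V →ₗ[k] W} {n : ℕ} {w : W}
    (hw : w ∈ pencilReach x y n) :
    ∃ v : ℕ → V, w = y (v 0) ∧ (∀ i, x (v i) = y (v (i + 1))) ∧ ∀ i, n ≤ i → v i = 0 := by
  induction n generalizing w with
  | zero =>
    rw [pencilReach, Submodule.mem_bot] at hw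
    exact ⟨0, by simp [hw]⟩
  | succ n ih =>
    obtain ⟨v₀, hv, rfl⟩ := hw
    obtain ⟨v, h0, hs, hz⟩ := ih hv
    refine ⟨fun i => Nat.casesOn i v₀ v, rfl, fun i => ?_, fun i hi => ?_⟩
    · cases i with
      | zero => exact h0
      | succ i => exact hs i
    · cases i with
      | zero => omega
      | succ i => exact hz i (by omega)

theorem exists_factor_of_forall_eq_zero {s : Module.Dual k V} {x : V →ₗ[k] W} {C : Submodule k W}
    (h : ∀ v, x v ∈ C → s v = 0) :
    ∃ r : Module.Dual k W, (∀ w ∈ C, r w = 0) ∧ s = r ∘ₗ x := by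
  have hs : s ∈ (LinearMap.ker (C.mkQ ∘ₗ x)).dualAnnihilator := by
    rw [Submodule.mem_dualAnnihilator]
    intro v hv
    exact h v (by simpa using hv)
  rw [← LinearMap.range_dualMap_eq_dualAnnihilator_ker] at hs
  obtain ⟨r, rfl⟩ := hs
  refine ⟨r ∘ₗ C.mkQ, fun w hw => ?_, rfl⟩
  rw [LinearMap.comp_apply, Submodule.mkQ_apply, (Submodule.Quotient.mk_eq_zero C).2 hw, map_zero]

theorem exists_functionals_of_dualAnnihilator {x y : V →ₗ[k] W} {n : ℕ} {s₀ : Module.Dual k W}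
    (hs : ∀ w ∈ pencilReach x y n, s₀ w = 0) :
    ∃ s : ℕ → Module.Dual k W, s 0 = s₀ ∧ ∀ i < n, s i ∘ₗ y = s (i + 1) ∘ₗ x := by
  induction n generalizing s₀ with
  | zero => exact ⟨fun _ => s₀, rfl, fun i hi => absurd hi (by omega)⟩
  | succ n ih =>
    obtain ⟨r, hr, h⟩ := exists_factor_of_forall_eq_zero (s := s₀ ∘ₗ y) (x := x)
      (C := pencilReach x y n) (fun v hv => hs _ ⟨v, hv, rfl⟩)
    obtain ⟨s, rfl, hs'⟩ := ih hr
    refine ⟨fun i => Nat.casesOn i s₀ s, rfl, fun i hi => ?_⟩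
    cases i with
    | zero => exact h
    | succ i => exact hs' i (by omega)

/-- Either a vector starts a short solution of the pencil equations, or a sequence of functionals
compatible with the pencil detects it. -/
theorem exists_functionals_of_notMem_pencilReach {x y : V →ₗ[k] W} {n : ℕ} {w : W}
    (hw : w ∉ pencilReach x y n) :
    ∃ s : ℕ → Module.Dual k W, s 0 w = 1 ∧ ∀ i < n, s i ∘ₗ y = s (i + 1) ∘ₗ x := by
  have h : ∃ s₀ : Module.Dual k W, s₀ w ≠ 0 ∧ ∀ w ∈ pencilReach x y n, s₀ w = 0 := by
    by_contra! hc
    refine hw ((Subspace.forall_mem_dualAnnihilator_apply_eq_zero_iff _ w).1 fun φ hφ => ?_)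
    by_contra h
    obtain ⟨w', hw', hne⟩ := hc φ h
    exact hne ((Submodule.mem_dualAnnihilator φ).1 hφ w' hw')
  obtain ⟨s₀, h1, h2⟩ := h
  obtain ⟨s, hs0, hs⟩ := exists_functionals_of_dualAnnihilator (x := x) (y := y)
    (n := n) (s₀ := (s₀ w)⁻¹ • s₀)
    (fun w hw => by simp [h2 w hw])
  exact ⟨s, by simp [hs0, h1], hs⟩

/-- The initial vectors `a 0` of the solutions of `x (a i) = y (a (i + 1))`, `i < n`. -/
def pencilDomain (x y : V →ₗ[k] W) : ℕ → Submodule k V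
  | 0 => ⊤
  | n + 1 => ((pencilDomain x y n).map y).comap x

theorem exists_of_mem_pencilDomain {x y : V →ₗ[k] W} {n : ℕ} {v : V}
    (hv : v ∈ pencilDomain x y n) :
    ∃ a : ℕ → V, a 0 = v ∧ ∀ i < n, x (a i) = y (a (i + 1)) := by
  induction n generalizing v with
  | zero => exact ⟨fun _ => v, rfl, fun i hi => absurd hi (by omega)⟩
  | succ n ih =>
    obtain ⟨v', hv', h⟩ := hv
    obtain ⟨a, rfl, ha⟩ := ih hv'
    refine ⟨fun i => Nat.casesOn i v a, rfl, fun i hi => ?_⟩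
    cases i with
    | zero => exact h.symm
    | succ i => exact ha i (by omega)

theorem exists_functionals_of_forall_mem_pencilDomain {x y : V →ₗ[k] W} {n : ℕ}
    {r : Module.Dual k V} (hr : ∀ v ∈ pencilDomain x y n, r v = 0) :
    ∃ s : ℕ → Module.Dual k W, r = s 0 ∘ₗ x ∧ (∀ i, s i ∘ₗ y = s (i + 1) ∘ₗ x) ∧
      ∀ i, n ≤ i → s i = 0 := by
  induction n generalizing r with
  | zero =>
    have : r = 0 := LinearMap.ext fun v => hr v trivial
    exact ⟨0, by simp [this], fun i => by simp, fun i _ => rfl⟩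
  | succ n ih =>
    obtain ⟨s₀, h1, h2⟩ := exists_factor_of_forall_eq_zero (s := r) (x := x)
      (C := (pencilDomain x y n).map y) hr
    obtain ⟨s, h0, hs, hz⟩ := ih (r := s₀ ∘ₗ y) (fun v hv => h1 _ ⟨v, hv, rfl⟩)
    refine ⟨fun i => Nat.casesOn i s₀ s, h2, fun i => ?_, fun i hi => ?_⟩
    · cases i with
      | zero => exact h0
      | succ i => exact hs i
    · cases i with
      | zero => omega
      | succ i => exact hz i (by omega)

end PencilChains

section KleinPairs

variable {k : Type*} [Field k] {A : Type*} [Ring A] [Algebra k A]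

/-- The presentation `A = k[x, y] / (x², y²)`, in characteristic two. -/
structure IsKleinPair (k : Type*) [Field k] {A : Type*} [Ring A] [Algebra k A] (x y : A) :
    Prop where
  two : (1 : A) + 1 = 0
  xx : x * x = 0
  yy : y * y = 0
  comm : y * x = x * y
  ne_zero : x * y ≠ 0
  exists_eq : ∀ a : A, ∃ α β γ δ : k, a = α • (1 : A) + β • x + γ • y + δ • (x * y)
  finrank_eq : Module.finrank k A = 4

namespace IsKleinPair

variable {x y : A} (h : IsKleinPair k x y)
include h

section Modules

variable {N : Type*} [AddCommGroup N] [Module A N]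

theorem add_self (m : N) : m + m = 0 := by
  rw [← one_smul A m, ← add_smul, h.two, zero_smul]

theorem xx_smul (m : N) : x • x • m = 0 := by rw [smul_smul, h.xx, zero_smul]

theorem yy_smul (m : N) : y • y • m = 0 := by rw [smul_smul, h.yy, zero_smul]

theorem yx_smul (m : N) : y • x • m = x • y • m := by rw [smul_smul, h.comm, mul_smul]

variable {N' : Type*} [AddCommGroup N'] [Module A N'] [Module k N] [IsScalarTower k A N]
  [Module k N'] [IsScalarTower k A N']

theorem exists_linearMap (f : N →ₗ[k] N') (hx : ∀ m, f (x • m) = x • f m)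
    (hy : ∀ m, f (y • m) = y • f m) : ∃ F : N →ₗ[A] N', ∀ m, F m = f m := by
  refine ⟨{ f with map_smul' := fun a m => ?_ }, fun m => rfl⟩
  obtain ⟨α, β, γ, δ, rfl⟩ := h.exists_eq a
  simp only [AddHom.toFun_eq_coe, LinearMap.coe_toAddHom, RingHom.id_apply, add_smul, smul_assoc,
    one_smul, map_add, map_smul, mul_smul, hx, hy]

theorem smul_mem_of_smul_mem {S : Submodule k N} (hx : ∀ m ∈ S, x • m ∈ S)
    (hy : ∀ m ∈ S, y • m ∈ S)
    (a : A) {m : N} (hm : m ∈ S) : a • m ∈ S := by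
  obtain ⟨α, β, γ, δ, rfl⟩ := h.exists_eq a
  simp only [add_smul, smul_assoc, one_smul, mul_smul]
  exact S.add_mem (S.add_mem (S.add_mem (S.smul_mem _ hm) (S.smul_mem _ (hx _ hm)))
    (S.smul_mem _ (hy _ hm))) (S.smul_mem _ (hx _ (hy _ hm)))

end Modules

/-- `A` is a Frobenius algebra: functionals on a module lift to `A`-linear maps to `A`. -/
theorem exists_frobenius {M : Type*} [AddCommGroup M] [Module A M] [Module k M]
    [IsScalarTower k A M] (φ : Module.Dual k M) :
    ∃ r : M →ₗ[A] A, ∀ m, r m = φ (x • y • m) • (1 : A) + φ (y • m) • x + φ (x • m) • y +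
      φ m • (x * y) := by
  let f : M →ₗ[k] A :=
    (φ ∘ₗ Algebra.lsmul k k M x ∘ₗ Algebra.lsmul k k M y).smulRight (1 : A) +
      (φ ∘ₗ Algebra.lsmul k k M y).smulRight x + (φ ∘ₗ Algebra.lsmul k k M x).smulRight y +
      φ.smulRight (x * y)
  have hf : ∀ m, f m = φ (x • y • m) • (1 : A) + φ (y • m) • x + φ (x • m) • y +
      φ m • (x * y) := fun m => rfl
  have e1 : x * (x * y) = 0 := by rw [← mul_assoc, h.xx, zero_mul]
  have e2 : y * (x * y) = 0 := by rw [← mul_assoc, h.comm, mul_assoc, h.yy, mul_zero]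
  obtain ⟨F, hF⟩ := h.exists_linearMap f (fun m => by
    simp only [hf, h.xx_smul, h.yx_smul, smul_eq_mul, mul_add, mul_smul_comm, mul_one, h.xx, e1,
      map_zero, zero_smul, smul_zero, zero_add, add_zero]) (fun m => by
    simp only [hf, h.yy_smul, smul_eq_mul, mul_add, mul_smul_comm, mul_one, h.yy, e2,
      map_zero, zero_smul, smul_zero, zero_add, add_zero, h.comm])
  exact ⟨F, fun m => by rw [hF, hf]⟩

/-- Coordinates with respect to `1, x, y, x * y`. -/
theorem coeff_eq_zero {α β γ δ : k}
    (e : α • (1 : A) + β • x + γ • y + δ • (x * y) = 0) : α = 0 ∧ β = 0 ∧ γ = 0 ∧ δ = 0 := by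
  have e1 : x * (x * y) = 0 := by rw [← mul_assoc, h.xx, zero_mul]
  have e2 : y * (x * y) = 0 := by rw [← mul_assoc, h.comm, mul_assoc, h.yy, mul_zero]
  have e3 : x * y * x = 0 := by rw [mul_assoc, h.comm, e1]
  have e4 : x * y * y = 0 := by rw [mul_assoc, h.yy, mul_zero]
  have hα : α = 0 := by
    have := congrArg (fun z => (x * y) * z) e
    simp only [mul_add, mul_smul_comm, mul_one, e3, e4, smul_zero, add_zero, mul_zero] at this
    rw [mul_assoc x y, e2, mul_zero, smul_zero, add_zero] at this
    exact (smul_eq_zero.1 this).resolve_right h.ne_zero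
  subst hα
  have hβ : β = 0 := by
    have := congrArg (fun z => y * z) e
    simp only [mul_add, mul_smul_comm, h.yy, h.comm, e2, smul_zero, add_zero, mul_zero,
      zero_smul, zero_add] at this
    exact (smul_eq_zero.1 this).resolve_right h.ne_zero
  subst hβ
  have hγ : γ = 0 := by
    have := congrArg (fun z => x * z) e
    simp only [mul_add, mul_smul_comm, e1, smul_zero, add_zero, mul_zero,
      zero_smul, zero_add] at this
    exact (smul_eq_zero.1 this).resolve_right h.ne_zero
  subst hγ
  simp only [zero_smul, zero_add] at e
  exact ⟨rfl, rfl, rfl, (smul_eq_zero.1 e).resolve_right h.ne_zero⟩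

/-- `A` is self-injective. -/
theorem exists_extension {X Y : Type*} [AddCommGroup X] [AddCommGroup Y] [Module A X] [Module A Y]
    (f : X →ₗ[A] Y) (hf : Function.Injective f) (g : X →ₗ[A] A) :
    ∃ r : Y →ₗ[A] A, ∀ m, r (f m) = g m := by
  let _ := Module.compHom X (algebraMap k A)
  let _ := Module.compHom Y (algebraMap k A)
  have : IsScalarTower k A X := ⟨fun c a m => by
    rw [Algebra.smul_def, mul_smul]; rfl⟩
  have : IsScalarTower k A Y := ⟨fun c a m => by
    rw [Algebra.smul_def, mul_smul]; rfl⟩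
  obtain ⟨q, hq⟩ := (f.restrictScalars k).exists_leftInverse_of_injective
    (LinearMap.ker_eq_bot.2 hf)
  have hqf : ∀ m, q (f m) = m := fun m => LinearMap.congr_fun hq m
  obtain ⟨ε, hε⟩ : ∃ ε : Module.Dual k A, ∀ α β γ δ : k,
      ε (α • (1 : A) + β • x + γ • y + δ • (x * y)) = δ := by
    have hli : LinearIndependent k ![(1 : A), x, y, x * y] := by
      rw [Fintype.linearIndependent_iff]
      intro c hc
      simp only [Fin.sum_univ_four, Matrix.cons_val] at hc
      obtain ⟨h0, h1, h2, h3⟩ := h.coeff_eq_zero hc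
      intro i
      fin_cases i <;> assumption
    have : Module.Finite k A := Module.finite_of_finrank_eq_succ h.finrank_eq
    let b := basisOfLinearIndependentOfCardEqFinrank hli (by simp [h.finrank_eq])
    have hb : ⇑b = ![(1 : A), x, y, x * y] := coe_basisOfLinearIndependentOfCardEqFinrank _ _
    refine ⟨b.coord 3, fun α β γ δ => ?_⟩
    have : α • (1 : A) + β • x + γ • y + δ • (x * y) =
        ∑ i, (![α, β, γ, δ] : Fin 4 → k) i • b i := by
      simp [hb, Fin.sum_univ_four]
    rw [this, Module.Basis.coord_apply, Module.Basis.repr_sum_self]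
    rfl
  obtain ⟨r, hr⟩ := h.exists_frobenius (M := Y) (ε ∘ₗ g.restrictScalars k ∘ₗ q)
  refine ⟨r, fun m => ?_⟩
  have key : ∀ a : A, ∀ φ : Module.Dual k A, (∀ α β γ δ : k,
      φ (α • (1 : A) + β • x + γ • y + δ • (x * y)) = δ) →
      φ (x * y * a) • (1 : A) + φ (y * a) • x + φ (x * a) • y + φ a • (x * y) = a := by
    intro a φ hφ
    have e1 : x * (x * y) = 0 := by rw [← mul_assoc, h.xx, zero_mul]
    have e2 : y * (x * y) = 0 := by rw [← mul_assoc, h.comm, mul_assoc, h.yy, mul_zero]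
    have e3 : x * y * x = 0 := by rw [mul_assoc, h.comm, e1]
    have e4 : x * y * y = 0 := by rw [mul_assoc, h.yy, mul_zero]
    have e5 : x * y * (x * y) = 0 := by rw [mul_assoc, e2, mul_zero]
    have f0 : φ (x * y) = 1 := by simpa using hφ 0 0 0 1
    have f1 : φ 1 = 0 := by simpa using hφ 1 0 0 0
    have f2 : φ x = 0 := by simpa using hφ 0 1 0 0
    have f3 : φ y = 0 := by simpa using hφ 0 0 1 0
    obtain ⟨α, β, γ, δ, rfl⟩ := h.exists_eq a
    simp only [mul_add, mul_smul_comm, mul_one, e1, e2, e3, e4, e5, h.xx, h.yy, h.comm, map_add,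
      map_smul, f0, f1, f2, f3, smul_zero, add_zero, zero_add, smul_eq_mul, mul_zero]
  have := key (g m) ε hε
  rw [hr]
  simp only [LinearMap.comp_apply, LinearMap.restrictScalars_apply, ← map_smul f, hqf,
    map_smul g, smul_eq_mul, ← mul_assoc]
  exact this

/-- The socle of a free module is `x * y` times the module, and it is essential. -/
theorem exists_smul_ne_zero {ι : Type*} {p : ι → A} (hp : p ≠ 0) :
    ∃ a : A, a • p ≠ 0 ∧ ∃ q : ι → A, a • p = (x * y) • q := by
  have e1 : x * (x * y) = 0 := by rw [← mul_assoc, h.xx, zero_mul]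
  have e2 : y * (x * y) = 0 := by rw [← mul_assoc, h.comm, mul_assoc, h.yy, mul_zero]
  have e3 : x * y * x = 0 := by rw [mul_assoc, h.comm, e1]
  have e4 : x * y * y = 0 := by rw [mul_assoc, h.yy, mul_zero]
  have e5 : x * y * (x * y) = 0 := by rw [mul_assoc, e2, mul_zero]
  choose α β γ δ hd using fun i => h.exists_eq (p i)
  have hxy : ∀ i, x * y * p i = α i • (x * y) := fun i => by
    rw [hd]
    simp only [mul_add, mul_smul_comm, mul_one, e3, e4, e5, smul_zero, add_zero]
  by_cases hα : ∀ i, α i = 0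
  · have hy : ∀ i, y * p i = β i • (x * y) := fun i => by
      rw [hd]
      simp only [hα, mul_add, mul_smul_comm, h.comm, h.yy, e2, smul_zero, add_zero, zero_smul,
        zero_add]
    have hx : ∀ i, x * p i = γ i • (x * y) := fun i => by
      rw [hd]
      simp only [hα, mul_add, mul_smul_comm, h.xx, e1, smul_zero, add_zero, zero_smul,
        zero_add]
    by_cases hβ : ∀ i, β i = 0
    · by_cases hγ : ∀ i, γ i = 0
      · refine ⟨1, by rwa [one_smul], fun i => δ i • 1, ?_⟩
        ext i
        rw [one_smul, hd]
        simp [hα, hβ, hγ]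
      · push Not at hγ
        obtain ⟨i, hi⟩ := hγ
        refine ⟨x, fun e => smul_ne_zero hi h.ne_zero ?_, fun i => γ i • 1, ?_⟩
        · rw [← hx]; exact congrFun e i
        · ext i
          simp [hx]
    · push Not at hβ
      obtain ⟨i, hi⟩ := hβ
      refine ⟨y, fun e => smul_ne_zero hi h.ne_zero ?_, fun i => β i • 1, ?_⟩
      · rw [← hy]; exact congrFun e i
      · ext i
        simp [hy]
  · push Not at hα
    obtain ⟨i, hi⟩ := hα
    refine ⟨x * y, fun e => smul_ne_zero hi h.ne_zero ?_, p, rfl⟩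
    rw [← hxy]; exact congrFun e i

end IsKleinPair

theorem isIsoToSummand_of_bijective {A : Type u} [Ring A] {N : Type w} [AddCommGroup N]
    [Module A N] {M : Type v} [AddCommGroup M] [Module A M] (f : N →ₗ[A] M) (g : M →ₗ[A] N)
    (hgf : Function.Bijective (g ∘ₗ f)) :
    IsCompl (LinearMap.range f) (LinearMap.ker g) ∧ Nonempty (N ≃ₗ[A] LinearMap.range f) := by
  refine ⟨⟨?_, ?_⟩, ⟨LinearEquiv.ofInjective f (Function.Injective.of_comp (f := g) hgf.1)⟩⟩
  · rw [Submodule.disjoint_def]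
    rintro _ ⟨n, rfl⟩ hn
    have : n = 0 := hgf.1 (by simpa using hn)
    rw [this, map_zero]
  · rw [codisjoint_iff, eq_top_iff]
    intro m _
    obtain ⟨n, hn⟩ := hgf.2 (g m)
    refine Submodule.mem_sup.2 ⟨f n, ⟨n, rfl⟩, m - f n, ?_, by abel⟩
    rw [LinearMap.mem_ker, map_sub, ← hn, LinearMap.comp_apply, sub_self]

/-- The socle of `A` annihilates projective-free modules. -/
theorem IsKleinPair.smul_eq_zero_of_isProjectiveFree {x y : A} (h : IsKleinPair k x y)
    {M : Type*} [AddCommGroup M] [Module A M] [Module k M] [IsScalarTower k A M]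
    (hM : IsProjectiveFree A M) (m : M) : x • y • m = 0 := by
  by_contra hm
  obtain ⟨φ, hφ⟩ := Module.Projective.exists_dual_ne_zero k hm
  obtain ⟨r, hr⟩ := h.exists_frobenius φ
  let f : A →ₗ[A] M := LinearMap.toSpanSingleton A M m
  have e1 : x * (x * y) = 0 := by rw [← mul_assoc, h.xx, zero_mul]
  have e2 : y * (x * y) = 0 := by rw [← mul_assoc, h.comm, mul_assoc, h.yy, mul_zero]
  have hxy : r (f (x * y)) = φ (x • y • m) • (x * y) := by
    rw [hr]
    simp only [f, LinearMap.toSpanSingleton_apply, smul_smul, e1, e2, zero_smul, map_zero,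
      smul_zero, zero_smul, map_zero, zero_add, add_zero]
  have hinj : Function.Injective (r ∘ₗ f) := by
    rw [← LinearMap.ker_eq_bot, eq_bot_iff]
    intro a ha
    by_contra hne
    obtain ⟨b, hb, q, hq⟩ := h.exists_smul_ne_zero (p := fun _ : Unit => a)
      (fun e => hne (congrFun e ()))
    replace hb : b * a ≠ 0 := fun e => hb (funext fun _ => e)
    replace hq : b * a = x * y * q () := congrFun hq ()
    obtain ⟨α, β, γ, δ, e⟩ := h.exists_eq (q ())
    have hq' : b * a = α • (x * y) := by
      rw [hq, e]
      simp only [mul_add, mul_smul_comm, mul_one, mul_assoc, h.comm, h.yy, e1, e2, mul_zero,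
        smul_zero, add_zero]
    have h0 : (r ∘ₗ f) (b * a) = 0 := by
      rw [← smul_eq_mul, map_smul, LinearMap.mem_ker.1 ha, smul_zero]
    rw [hq', ← smul_one_smul A α (x * y), map_smul, LinearMap.comp_apply, hxy, smul_one_smul,
      smul_smul] at h0
    have hα : α ≠ 0 := fun e => hb (by rw [hq', e, zero_smul])
    exact smul_ne_zero (mul_ne_zero hα hφ) h.ne_zero h0
  have : Module.Finite k A := Module.finite_of_finrank_eq_succ h.finrank_eq
  have hbij : Function.Bijective (r ∘ₗ f) :=
    ⟨hinj, (LinearMap.injective_iff_surjective (f := (r ∘ₗ f).restrictScalars k)).1 hinj⟩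
  obtain ⟨hc, ⟨e⟩⟩ := isIsoToSummand_of_bijective f r hbij
  have := hM _ _ hc (Module.Projective.of_equiv e)
  rw [LinearMap.range_eq_bot] at this
  refine hm ?_
  have h1 : f (x * y) = 0 := by rw [this, LinearMap.zero_apply]
  rwa [LinearMap.toSpanSingleton_apply, mul_smul] at h1

end KleinPairs

section Zigzags

variable {k : Type*} [Field k] {A : Type*} [Ring A] [Algebra k A]
  {N : Type*} [AddCommGroup N] [Module A N] [Module k N] [IsScalarTower k A N]
  {M : Type*} [AddCommGroup M] [Module A M] [Module k M] [IsScalarTower k A M]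

/-- Chains for the action of `x` and `y` on a module. -/
abbrev IsModuleChain (k : Type*) [Field k] {A : Type*} [Ring A] [Algebra k A] {N : Type*}
    [AddCommGroup N] [Module A N] [Module k N] [IsScalarTower k A N] (x y : A) (n : ℕ)
    (a : ℕ → N) : Prop :=
  IsPencilChain (Algebra.lsmul k k N x) (Algebra.lsmul k k N y) n a

/-- `N` has a basis `a 0, …, a n, x • a 0, …, x • a (n - 1)` for a chain `a`. -/
structure IsZigzagBasis (x y : A) (n : ℕ) (B : Module.Basis (Fin (n + 1) ⊕ Fin n) k N)
    (a : ℕ → N) : Prop where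
  chain : IsModuleChain k x y n a
  inl : ∀ i, B (Sum.inl i) = a i
  inr : ∀ i, B (Sum.inr i) = x • a i

/-- `N` has a basis `a 0, …, a (n - 1), b 0, …, b n` with `y • a i = b i`, `x • a i = b (i + 1)`
and `b` in the socle. -/
structure IsCozigzagBasis (x y : A) (n : ℕ) (B : Module.Basis (Fin n ⊕ Fin (n + 1)) k N) :
    Prop where
  y_inl : ∀ i, y • B (Sum.inl i) = B (Sum.inr i.castSucc)
  x_inl : ∀ i, x • B (Sum.inl i) = B (Sum.inr i.succ)
  y_inr : ∀ i, y • B (Sum.inr i) = 0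
  x_inr : ∀ i, x • B (Sum.inr i) = 0

/-- Chains of functionals on `M`. -/
abbrev IsModuleCochain (k : Type*) [Field k] {A : Type*} [Ring A] [Algebra k A] {N : Type*}
    [AddCommGroup N] [Module A N] [Module k N] [IsScalarTower k A N] (x y : A) (n : ℕ)
    (s : ℕ → Module.Dual k N) : Prop :=
  IsPencilChain (Algebra.lsmul k k N y).dualMap (Algebra.lsmul k k N x).dualMap n s

theorem Module.Basis.injective_of_linearIndependent {ι : Type*} (B : Module.Basis ι k N)
    (f : N →ₗ[k] M) (hf : LinearIndependent k (f ∘ B)) : Function.Injective f := by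
  rw [← LinearMap.ker_eq_bot, eq_bot_iff]
  intro m hm
  have e : Finsupp.linearCombination k (f ∘ B) (B.repr m) = 0 := by
    rw [← LinearMap.mem_ker.1 hm, ← Finsupp.apply_linearCombination, B.linearCombination_repr]
  simpa using linearIndependent_iff.1 hf _ e

namespace IsKleinPair

variable {x y : A} (h : IsKleinPair k x y)
include h

theorem linearIndependent_chain {n : ℕ} (hn : 0 < n) {a : ℕ → N} (ha : IsModuleChain k x y n a)
    (hli : LinearIndependent k (fun i : Fin n => x • a i)) :
    LinearIndependent k (Sum.elim (fun i : Fin (n + 1) => a i) (fun i : Fin n => x • a i)) := by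
  have hxy : ∀ i, x • a i = y • a (i + 1) := ha.map_succ
  have hy0 : y • a 0 = 0 := ha.map_zero
  have hxn : x • a n = 0 := ha.map_last le_rfl
  rw [Fintype.linearIndependent_iff] at hli ⊢
  intro c hc
  simp only [Fintype.sum_sum_type, Sum.elim_inl, Sum.elim_inr] at hc
  have h1 : ∀ i : Fin n, c (Sum.inl i.castSucc) = 0 := by
    apply hli
    have := congrArg (x • ·) hc
    simpa [Finset.smul_sum, smul_comm x, h.xx_smul, Fin.sum_univ_castSucc, hxn] using this
  have h2 : c (Sum.inl (Fin.last n)) = 0 := by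
    obtain ⟨m, rfl⟩ : ∃ m, n = m + 1 := ⟨n - 1, by omega⟩
    have h0 := congrArg (y • ·) hc
    have hyx : ∀ i, y • x • a i = 0 := fun i => by rw [hxy, h.yy_smul]
    simp only [smul_add, Finset.smul_sum, smul_comm y (_ : k), hyx, smul_zero,
      Finset.sum_const_zero, add_zero] at h0
    rw [Fin.sum_univ_castSucc] at h0
    simp only [h1, zero_smul, Finset.sum_const_zero, zero_add, Fin.val_last, ← hxy] at h0
    have := hli (fun i => if i = Fin.last m then c (Sum.inl (Fin.last (m + 1))) else 0)
      (by simpa [ite_smul] using h0) (Fin.last m)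
    simpa using this
  rw [Fin.sum_univ_castSucc] at hc
  simp only [h1, h2, zero_smul, Finset.sum_const_zero, zero_add] at hc
  have h3 := hli _ hc
  rintro (i | i)
  · induction i using Fin.lastCases with
    | last => exact h2
    | cast i => exact h1 i
  · exact h3 i

/-- Chains are represented by zigzag modules. -/
theorem exists_zigzag_lift {n : ℕ} {B : Module.Basis (Fin (n + 1) ⊕ Fin n) k N} {a : ℕ → N}
    (hB : IsZigzagBasis x y n B a) {a' : ℕ → M} (ha' : IsModuleChain k x y n a') :
    ∃ F : N →ₗ[A] M, ∀ i, F (a i) = a' i := by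
  let f : N →ₗ[k] M := B.constr k (Sum.elim (fun i : Fin (n + 1) => a' i)
    (fun i : Fin n => x • a' i))
  have hfa : ∀ i, f (a i) = a' i := fun i => by
    by_cases hi : i < n + 1
    · have := hB.inl ⟨i, hi⟩
      rw [← this, B.constr_basis]
      rfl
    · rw [hB.chain.eq_zero _ (by omega), ha'.eq_zero _ (by omega), map_zero]
  have hfx : ∀ i, f (x • a i) = x • a' i := fun i => by
    by_cases hi : i < n
    · have := hB.inr ⟨i, hi⟩
      rw [← this, B.constr_basis]
      rfl
    · rw [show x • a i = 0 from hB.chain.map_last (by omega),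
        show x • a' i = 0 from ha'.map_last (by omega), map_zero]
  have hxy : ∀ i, x • a i = y • a (i + 1) := hB.chain.map_succ
  have hxy' : ∀ i, x • a' i = y • a' (i + 1) := ha'.map_succ
  obtain ⟨F, hF⟩ := h.exists_linearMap f (fun m => by
    refine LinearMap.congr_fun (f := f ∘ₗ Algebra.lsmul k k N x)
      (g := Algebra.lsmul k k M x ∘ₗ f) (B.ext ?_) m
    rintro (i | i)
    · simp [hB.inl, hfa, hfx]
    · simp [hB.inr, hfx, h.xx_smul]) (fun m => by
    refine LinearMap.congr_fun (f := f ∘ₗ Algebra.lsmul k k N y)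
      (g := Algebra.lsmul k k M y ∘ₗ f) (B.ext ?_) m
    rintro (i | i)
    · simp only [LinearMap.comp_apply, Algebra.lsmul_coe, hB.inl, hfa]
      obtain ⟨_ | i, hi⟩ := i
      · simp only [show y • a 0 = 0 from hB.chain.map_zero,
          show y • a' 0 = 0 from ha'.map_zero, map_zero]
      · simp only [← hxy, ← hxy', hfx]
    · simp only [LinearMap.comp_apply, Algebra.lsmul_coe, hB.inr, hfx]
      rw [hxy, hxy', h.yy_smul, h.yy_smul, map_zero])
  exact ⟨F, fun i => by rw [hF, hfa]⟩

theorem injective_of_zigzag {n : ℕ} (hn : 0 < n) {B : Module.Basis (Fin (n + 1) ⊕ Fin n) k N}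
    {a : ℕ → N} (hB : IsZigzagBasis x y n B a) (F : N →ₗ[A] M)
    (hli : LinearIndependent k (fun i : Fin n => F (x • a i))) : Function.Injective F := by
  have hc : IsModuleChain k x y n (fun i => F (a i)) := by
    refine ⟨?_, fun i => ?_, fun i hi => by simp [hB.chain.eq_zero i hi]⟩
    · have : y • a 0 = 0 := hB.chain.map_zero
      change y • F (a 0) = 0
      rw [← map_smul F, this, map_zero]
    · have : x • a i = y • a (i + 1) := hB.chain.map_succ i
      change x • F (a i) = y • F (a (i + 1))
      rw [← map_smul F, ← map_smul F, this]
  have := h.linearIndependent_chain hn hc (by simpa using hli)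
  refine Module.Basis.injective_of_linearIndependent B (F.restrictScalars k) ?_
  convert this using 1
  ext (i | i)
  · simp [hB.inl]
  · simp [hB.inr]

theorem exists_cozigzag_lift {n : ℕ} {B : Module.Basis (Fin n ⊕ Fin (n + 1)) k N}
    (hB : IsCozigzagBasis x y n B) {s : ℕ → Module.Dual k M} (hs : IsModuleCochain k x y n s) :
    ∃ F : M →ₗ[A] N, ∀ m, F m = ∑ i : Fin n, s i (y • m) • B (Sum.inl i) +
      ∑ i : Fin (n + 1), s i m • B (Sum.inr i) := by
  have h0 : ∀ m, s 0 (x • m) = 0 := fun m => LinearMap.congr_fun hs.map_zero m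
  have h1 : ∀ i m, s i (y • m) = s (i + 1) (x • m) := fun i m =>
    LinearMap.congr_fun (hs.map_succ i) m
  have h2 : ∀ m, s n (y • m) = 0 := fun m => LinearMap.congr_fun (hs.map_last le_rfl) m
  let f : M →ₗ[k] N := ∑ i : Fin n, (s i ∘ₗ Algebra.lsmul k k M y).smulRight (B (Sum.inl i)) +
      ∑ i : Fin (n + 1), (s i).smulRight (B (Sum.inr i))
  have hf : ∀ m, f m = ∑ i : Fin n, s i (y • m) • B (Sum.inl i) +
      ∑ i : Fin (n + 1), s i m • B (Sum.inr i) := fun m => by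
    simp [f, LinearMap.sum_apply]
  obtain ⟨F, hF⟩ := h.exists_linearMap f (fun m => by
    simp only [hf, h1, h.xx_smul, map_zero, zero_smul, Finset.sum_const_zero, zero_add, smul_add,
      Finset.smul_sum, smul_comm x (_ : k), hB.x_inl, hB.x_inr, smul_zero, add_zero]
    rw [Fin.sum_univ_succ]
    simp [h0]) (fun m => by
    simp only [hf, h.yy_smul, map_zero, zero_smul, Finset.sum_const_zero, zero_add, smul_add,
      Finset.smul_sum, smul_comm y (_ : k), hB.y_inl, hB.y_inr, smul_zero, add_zero]
    rw [Fin.sum_univ_castSucc]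
    simp [h2])
  exact ⟨F, fun m => by rw [hF, hf]⟩

/-- Maps out of a cozigzag module. -/
theorem exists_cozigzag_desc (hM : ∀ m : M, x • y • m = 0) {n : ℕ}
    {B : Module.Basis (Fin n ⊕ Fin (n + 1)) k N} (hB : IsCozigzagBasis x y n B) {a : ℕ → M}
    (ha : ∀ i, i + 1 < n → x • a i = y • a (i + 1)) :
    ∃ F : N →ₗ[A] M, ∀ i : Fin n, F (B (Sum.inl i)) = a i := by
  let f : N →ₗ[k] M := B.constr k (Sum.elim (fun i : Fin n => a i)
    (Fin.cases (y • a 0) (fun i : Fin n => x • a i)))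
  have hl : ∀ i, f (B (Sum.inl i)) = a i := fun i => by rw [B.constr_basis]; rfl
  have h0 : f (B (Sum.inr 0)) = y • a 0 := by rw [B.constr_basis]; rfl
  have hs : ∀ i : Fin n, f (B (Sum.inr i.succ)) = x • a i := fun i => by
    rw [B.constr_basis]; rfl
  obtain ⟨F, hF⟩ := h.exists_linearMap f (fun m => by
    refine LinearMap.congr_fun (f := f ∘ₗ Algebra.lsmul k k N x)
      (g := Algebra.lsmul k k M x ∘ₗ f) (B.ext ?_) m
    rintro (i | i)
    · simp [hB.x_inl, hl, hs]
    · simp only [LinearMap.comp_apply, Algebra.lsmul_coe, hB.x_inr, map_zero]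
      induction i using Fin.cases with
      | zero => rw [h0, hM]
      | succ i => rw [hs, h.xx_smul]) (fun m => by
    refine LinearMap.congr_fun (f := f ∘ₗ Algebra.lsmul k k N y)
      (g := Algebra.lsmul k k M y ∘ₗ f) (B.ext ?_) m
    rintro (i | i)
    · simp only [LinearMap.comp_apply, Algebra.lsmul_coe, hB.y_inl, hl]
      obtain ⟨_ | i, hi⟩ := i
      · exact h0
      · rw [← ha i hi]
        exact hs ⟨i, by omega⟩
    · simp only [LinearMap.comp_apply, Algebra.lsmul_coe, hB.y_inr, map_zero]
      induction i using Fin.cases with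
      | zero => rw [h0, h.yy_smul]
      | succ i => rw [hs, h.yx_smul, hM])
  exact ⟨F, fun i => by rw [hF, hl]⟩

end IsKleinPair

theorem IsCozigzagBasis.surjective {x y : A} {n : ℕ} (hn : 0 < n)
    {B : Module.Basis (Fin n ⊕ Fin (n + 1)) k N}
    (hB : IsCozigzagBasis x y n B) (F : M →ₗ[A] N)
    (hF : ∀ i : Fin n, ∃ m, ∃ c : Fin (n + 1) → k,
      F m = B (Sum.inl i) + ∑ j, c j • B (Sum.inr j)) : Function.Surjective F := by
  have hinr : ∀ j, B (Sum.inr j) ∈ LinearMap.range (F.restrictScalars k) := by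
    have hy : ∀ i : Fin n, B (Sum.inr i.castSucc) ∈ LinearMap.range (F.restrictScalars k) := by
      intro i
      obtain ⟨m, c, e⟩ := hF i
      refine ⟨y • m, ?_⟩
      simp [e, hB.y_inl, Finset.smul_sum, smul_comm y (_ : k), hB.y_inr]
    intro j
    induction j using Fin.lastCases with
    | cast i => exact hy i
    | last =>
      obtain ⟨p, rfl⟩ : ∃ p, n = p + 1 := ⟨n - 1, by omega⟩
      obtain ⟨m, c, e⟩ := hF (Fin.last p)
      refine ⟨x • m, ?_⟩
      simp [e, hB.x_inl, Finset.smul_sum, smul_comm x (_ : k), hB.x_inr]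
  have : LinearMap.range (F.restrictScalars k) = ⊤ := by
    rw [eq_top_iff, ← B.span_eq, Submodule.span_le]
    rintro _ ⟨i | j, rfl⟩
    · obtain ⟨m, c, e⟩ := hF i
      rw [← sub_eq_iff_eq_add] at e
      rw [SetLike.mem_coe, ← e]
      exact Submodule.sub_mem _ ⟨m, rfl⟩
        (Submodule.sum_mem _ fun j _ => Submodule.smul_mem _ _ (hinr j))
    · exact hinr j
  exact (LinearMap.range_eq_top (f := F.restrictScalars k)).1 this

end Zigzags

section Uniqueness

variable {A : Type u} [Ring A]

theorem IsProjectiveCover.ker_equiv {P P' X : Type*} [AddCommGroup P] [Module A P]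
    [AddCommGroup P'] [Module A P'] [AddCommGroup X] [Module A X] {f : P →ₗ[A] X}
    {f' : P' →ₗ[A] X} (hf : IsProjectiveCover f) (hf' : IsProjectiveCover f') :
    Nonempty (LinearMap.ker f ≃ₗ[A] LinearMap.ker f') := by
  have := hf.projective
  have := hf'.projective
  obtain ⟨g, hg⟩ := Module.projective_lifting_property f' f hf'.surjective
  have hg' : ∀ p, f' (g p) = f p := fun p => LinearMap.congr_fun hg p
  have hgs : Function.Surjective g := by
    rw [← LinearMap.range_eq_top]
    refine hf'.superfluous _ (eq_top_iff.2 fun q _ => ?_)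
    obtain ⟨p, hp⟩ := hf.surjective (f' q)
    refine Submodule.mem_sup.2 ⟨g p, ⟨p, rfl⟩, q - g p, ?_, by abel⟩
    rw [LinearMap.mem_ker, map_sub, hg', hp, sub_self]
  obtain ⟨s, hs⟩ := Module.projective_lifting_property g LinearMap.id hgs
  have hs' : ∀ q, g (s q) = q := fun q => LinearMap.congr_fun hs q
  have hss : Function.Surjective s := by
    rw [← LinearMap.range_eq_top]
    refine hf.superfluous _ (eq_top_iff.2 fun p _ => ?_)
    refine Submodule.mem_sup.2 ⟨s (g p), ⟨g p, rfl⟩, p - s (g p), ?_, by abel⟩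
    rw [LinearMap.mem_ker, map_sub, ← hg' (s (g p)), hs', hg', sub_self]
  have hgi : Function.Injective g := by
    intro p p' hpp
    obtain ⟨q, rfl⟩ := hss p
    obtain ⟨q', rfl⟩ := hss p'
    rw [hs', hs'] at hpp
    rw [hpp]
  let e : P ≃ₗ[A] P' := LinearEquiv.ofBijective g ⟨hgi, hgs⟩
  refine ⟨e.ofSubmodules _ _ ?_⟩
  ext q
  simp only [Submodule.mem_map, LinearMap.mem_ker]
  constructor
  · rintro ⟨p, hp, rfl⟩
    exact (hg' p).trans hp
  · intro hq
    obtain ⟨p, rfl⟩ := hgs q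
    exact ⟨p, (hg' p).symm.trans hq, rfl⟩

theorem IsInjectiveHull.coker_equiv {I I' X : Type v} [AddCommGroup I] [Module A I]
    [AddCommGroup I'] [Module A I'] [AddCommGroup X] [Module A X] {f : X →ₗ[A] I}
    {f' : X →ₗ[A] I'} (hf : IsInjectiveHull f) (hf' : IsInjectiveHull f') :
    Nonempty ((I ⧸ LinearMap.range f) ≃ₗ[A] (I' ⧸ LinearMap.range f')) := by
  obtain ⟨g, hg⟩ := hf'.injective_module.out f hf.injective f'
  have hgi : Function.Injective g := by
    rw [← LinearMap.ker_eq_bot]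
    refine hf.essential _ (eq_bot_iff.2 ?_)
    rintro _ ⟨hp, m, rfl⟩
    have : f' m = 0 := (hg m).symm.trans hp
    rw [(map_eq_zero_iff f' hf'.injective).1 this, map_zero]
    exact zero_mem _
  obtain ⟨s, hs⟩ := hf.injective_module.out g hgi LinearMap.id
  have hsi : Function.Injective s := by
    rw [← LinearMap.ker_eq_bot]
    refine hf'.essential _ (eq_bot_iff.2 ?_)
    rintro _ ⟨hp, m, rfl⟩
    have : f m = 0 := by
      rw [← LinearMap.id_apply (R := A) (f m), ← hs, hg]; exact hp
    rw [(map_eq_zero_iff f hf.injective).1 this, map_zero]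
    exact zero_mem _
  have hgs : Function.Surjective g := fun q => ⟨s q, hsi (hs (s q))⟩
  let e : I ≃ₗ[A] I' := LinearEquiv.ofBijective g ⟨hgi, hgs⟩
  refine ⟨Submodule.Quotient.equiv _ _ e ?_⟩
  ext q
  simp only [Submodule.mem_map, LinearMap.mem_range]
  constructor
  · rintro ⟨_, ⟨m, rfl⟩, rfl⟩
    exact ⟨m, (hg m).symm⟩
  · rintro ⟨m, rfl⟩
    exact ⟨f m, ⟨m, rfl⟩, hg m⟩

end Uniqueness

section Syzygies

variable {k : Type*} [Field k] {A : Type*} [Ring A] [Algebra k A]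
  {N : Type*} [AddCommGroup N] [Module A N]

/-- `N` is a zigzag module, for the `k`-structure underlying its `A`-module structure. -/
def HasZigzagBasis (k : Type*) [Field k] {A : Type*} [Ring A] [Algebra k A] (x y : A) (n : ℕ)
    (N : Type*) [AddCommGroup N] [Module A N] : Prop :=
  ∃ (_ : Module k N) (_ : IsScalarTower k A N) (B : Module.Basis (Fin (n + 1) ⊕ Fin n) k N)
    (a : ℕ → N), IsZigzagBasis x y n B a

/-- `N` is a cozigzag module, for the `k`-structure underlying its `A`-module structure. -/
def HasCozigzagBasis (k : Type*) [Field k] {A : Type*} [Ring A] [Algebra k A] (x y : A) (n : ℕ)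
    (N : Type*) [AddCommGroup N] [Module A N] : Prop :=
  ∃ (_ : Module k N) (_ : IsScalarTower k A N) (B : Module.Basis (Fin n ⊕ Fin (n + 1)) k N),
    IsCozigzagBasis x y n B

theorem isScalarTower_compHom (k : Type*) [Field k] (A : Type*) [Ring A] [Algebra k A]
    (N : Type*) [AddCommGroup N] [Module A N] :
    letI := Module.compHom N (algebraMap k A); IsScalarTower k A N :=
  letI := Module.compHom N (algebraMap k A)
  ⟨fun c a m => by rw [Algebra.smul_def, mul_smul]; rfl⟩

theorem HasZigzagBasis.of_equiv {x y : A} {n : ℕ} {N' : Type*} [AddCommGroup N'] [Module A N']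
    (hN : HasZigzagBasis k x y n N) (e : N ≃ₗ[A] N') : HasZigzagBasis k x y n N' := by
  obtain ⟨_, _, B, a, hB⟩ := hN
  let _ := Module.compHom N' (algebraMap k A)
  have := isScalarTower_compHom k A N'
  refine ⟨inferInstance, inferInstance, B.map (e.restrictScalars k), fun i => e (a i),
    ⟨?_, fun i => ?_, fun i => ?_⟩, fun i => ?_, fun i => ?_⟩
  · change y • e (a 0) = 0
    have : y • a 0 = 0 := hB.chain.map_zero
    rw [← map_smul e, this, map_zero]
  · change x • e (a i) = y • e (a (i + 1))
    have : x • a i = y • a (i + 1) := hB.chain.map_succ i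
    rw [← map_smul e, ← map_smul e, this]
  · exact fun hi => by rw [hB.chain.eq_zero i hi, map_zero]
  · simp [hB.inl]
  · simp [hB.inr]

theorem HasCozigzagBasis.of_equiv {x y : A} {n : ℕ} {N' : Type*} [AddCommGroup N'] [Module A N']
    (hN : HasCozigzagBasis k x y n N) (e : N ≃ₗ[A] N') : HasCozigzagBasis k x y n N' := by
  obtain ⟨_, _, B, hB⟩ := hN
  let _ := Module.compHom N' (algebraMap k A)
  have := isScalarTower_compHom k A N'
  refine ⟨inferInstance, inferInstance, B.map (e.restrictScalars k), ⟨?_, ?_, ?_, ?_⟩⟩ <;> intro i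
  · simp [← map_smul e, hB.y_inl]
  · simp [← map_smul e, hB.x_inl]
  · simp [← map_smul e, hB.y_inr]
  · simp [← map_smul e, hB.x_inr]

/-- The standard basis of `A ^ n`, extended by zero. -/
def stdVec (A : Type*) [Ring A] (n i : ℕ) : Fin n → A := fun j => if (j : ℕ) = i then 1 else 0

theorem stdVec_eq_zero {n i : ℕ} (hi : n ≤ i) : stdVec A n i = 0 := by
  ext j
  exact if_neg (by omega)

theorem sum_smul_stdVec {n : ℕ} (p : Fin n → A) : p = ∑ i, p i • stdVec A n i := by
  ext j
  simp [stdVec, Finset.sum_apply, ← Fin.ext_iff]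

namespace IsKleinPair

variable {x y : A} (h : IsKleinPair k x y)
include h

theorem finrank_pi (n : ℕ) : Module.finrank k (Fin n → A) = 4 * n := by
  have : Module.Finite k A := Module.finite_of_finrank_eq_succ h.finrank_eq
  simp [Module.finrank_pi_fintype, h.finrank_eq, mul_comm]

theorem eq_top_of_sup_eq_top {P : Type*} [AddCommGroup P] [Module A P] {K L : Submodule A P}
    (hL : ∀ p ∈ L, ∃ p₁ p₂, p = x • p₁ + y • p₂) (hK : K ⊔ L = ⊤) : K = ⊤ := by
  have h1 : ∀ p, ∃ u ∈ K, ∃ p₁ p₂, p = u + (x • p₁ + y • p₂) := fun p => by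
    obtain ⟨u, hu, z, hz, rfl⟩ := Submodule.mem_sup.1 (hK ▸ Submodule.mem_top : p ∈ K ⊔ L)
    obtain ⟨p₁, p₂, rfl⟩ := hL z hz
    exact ⟨u, hu, p₁, p₂, rfl⟩
  have h2 : ∀ p, ∃ u ∈ K, ∃ q, p = u + x • y • q := fun p => by
    obtain ⟨u, hu, p₁, p₂, rfl⟩ := h1 p
    obtain ⟨u₁, hu₁, q₁, q₂, rfl⟩ := h1 p₁
    obtain ⟨u₂, hu₂, r₁, r₂, rfl⟩ := h1 p₂
    refine ⟨u + (x • u₁ + y • u₂), K.add_mem hu (K.add_mem (K.smul_mem _ hu₁)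
      (K.smul_mem _ hu₂)), q₂ + r₁, ?_⟩
    simp only [smul_add, h.xx_smul, h.yy_smul, h.yx_smul]
    abel
  rw [eq_top_iff]
  intro p _
  obtain ⟨u, hu, q, rfl⟩ := h2 p
  obtain ⟨u', hu', q', rfl⟩ := h2 q
  have : x • y • x • y • q' = 0 := by rw [h.yx_smul, h.xx_smul]
  rw [smul_add, smul_add, this, add_zero]
  exact K.add_mem hu (K.smul_mem _ (K.smul_mem _ hu'))

theorem exists_mul_eq (a : A) : ∃ c : k, x * y * a = c • (x * y) := by
  have e1 : x * (x * y) = 0 := by rw [← mul_assoc, h.xx, zero_mul]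
  have e2 : y * (x * y) = 0 := by rw [← mul_assoc, h.comm, mul_assoc, h.yy, mul_zero]
  obtain ⟨α, β, γ, δ, rfl⟩ := h.exists_eq a
  refine ⟨α, ?_⟩
  simp only [mul_add, mul_smul_comm, mul_one, mul_assoc, h.comm, h.yy, e1, e2, mul_zero,
    smul_zero, add_zero]

theorem exists_projectiveCover {n : ℕ} (hN : HasZigzagBasis k x y n N) :
    ∃ f : (Fin (n + 1) → A) →ₗ[A] N, IsProjectiveCover f ∧
      HasZigzagBasis k x y (n + 1) (LinearMap.ker f) := by
  obtain ⟨_, _, B, a, hB⟩ := hN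
  have hxy : ∀ i, x • a i = y • a (i + 1) := hB.chain.map_succ
  have hfin : Module.Finite k A := Module.finite_of_finrank_eq_succ h.finrank_eq
  let f : (Fin (n + 1) → A) →ₗ[A] N := Fintype.linearCombination A (fun i => a i)
  let e := stdVec A (n + 1)
  have hfe : ∀ i, f (e i) = a i := fun i => by
    by_cases hi : i < n + 1
    · have : ∀ j : Fin (n + 1), (j : ℕ) = i ↔ j = ⟨i, hi⟩ := fun j => by rw [Fin.ext_iff]
      simp [f, e, stdVec, Fintype.linearCombination_apply, this]
    · rw [show e i = 0 from stdVec_eq_zero (by omega), map_zero,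
        hB.chain.eq_zero _ (by omega)]
  have hsurj : Function.Surjective f := by
    refine (LinearMap.range_eq_top (f := f.restrictScalars k)).1 ?_
    rw [eq_top_iff, ← B.span_eq, Submodule.span_le]
    rintro _ ⟨i | i, rfl⟩
    · exact ⟨e i, by simp [hfe, hB.inl]⟩
    · exact ⟨x • e i, by simp [hfe, hB.inr]⟩
  let c : ℕ → (Fin (n + 1) → A) := fun i => Nat.casesOn i (y • e 0) fun i => x • e i + y • e (i + 1)
  have hc : ∀ i, c i ∈ LinearMap.ker f := fun i => by
    rw [LinearMap.mem_ker]
    cases i with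
    | zero => exact (map_smul f _ _).trans ((hfe 0).symm ▸ hB.chain.map_zero)
    | succ i =>
      change f (x • e i + y • e (i + 1)) = 0
      rw [map_add, map_smul, map_smul, hfe, hfe, hxy, h.add_self]
  have hxc : ∀ i, x • c i = x • y • e i := fun i => by
    cases i with
    | zero => rfl
    | succ i =>
      change x • (x • e i + y • e (i + 1)) = _
      rw [smul_add, h.xx_smul, zero_add]
  have hyc : ∀ i, y • c (i + 1) = x • y • e i := fun i => by
    change y • (x • e i + y • e (i + 1)) = _
    rw [smul_add, h.yy_smul, add_zero, h.yx_smul]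
  let c' : ℕ → LinearMap.ker f := fun i => ⟨c i, hc i⟩
  have hchain : IsModuleChain k x y (n + 1) c' := by
    refine ⟨Subtype.ext (h.yy_smul (e 0)), fun i => Subtype.ext ((hxc i).trans (hyc i).symm),
      fun i hi => Subtype.ext ?_⟩
    obtain ⟨i, rfl⟩ : ∃ j, i = j + 1 := ⟨i - 1, by omega⟩
    change x • e i + y • e (i + 1) = 0
    rw [show e i = 0 from stdVec_eq_zero (by omega),
      show e (i + 1) = 0 from stdVec_eq_zero (by omega), smul_zero, smul_zero, add_zero]
  have hli : LinearIndependent k (fun i : Fin (n + 1) => x • c' i) := by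
    rw [Fintype.linearIndependent_iff]
    intro g hg j
    have h1 := congrFun (congrArg Subtype.val hg) j
    have h2 : (((∑ i : Fin (n + 1), g i • x • c' i : LinearMap.ker f) : Fin (n + 1) → A)) j =
        g j • (x * y) := by
      have : ∀ i : Fin (n + 1), ((x • c' i : LinearMap.ker f) : Fin (n + 1) → A) = x • y • e i :=
        fun i => hxc i
      rw [AddSubmonoidClass.coe_finsetSum, Finset.sum_apply]
      simp [this, e, stdVec, ← Fin.ext_iff]
    rw [h2] at h1
    exact (smul_eq_zero.1 h1).resolve_right h.ne_zero
  have hli' := h.linearIndependent_chain n.succ_pos hchain hli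
  have hrank : Fintype.card (Fin (n + 1 + 1) ⊕ Fin (n + 1)) =
      Module.finrank k (LinearMap.ker f) := by
    have h1 := (f.restrictScalars k).finrank_range_add_finrank_ker
    rw [(LinearMap.range_eq_top (f := f.restrictScalars k)).2 hsurj, finrank_top,
      Module.finrank_eq_card_basis B, h.finrank_pi] at h1
    have h2 : Module.finrank k (LinearMap.ker (f.restrictScalars k)) =
      Module.finrank k (LinearMap.ker f) := rfl
    simp only [Fintype.card_sum, Fintype.card_fin] at h1 ⊢
    omega
  let B' := basisOfLinearIndependentOfCardEqFinrank hli' hrank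
  have hB' : ⇑B' = _ := coe_basisOfLinearIndependentOfCardEqFinrank hli' hrank
  refine ⟨f, ⟨inferInstance, hsurj, fun K => h.eq_top_of_sup_eq_top ?_⟩,
    ⟨inferInstance, inferInstance, B', c', hchain, fun i => by rw [hB']; rfl,
      fun i => by rw [hB']; rfl⟩⟩
  let T : Submodule k (Fin (n + 1) → A) := LinearMap.range (Algebra.lsmul k k _ x) ⊔
    LinearMap.range (Algebra.lsmul k k _ y)
  have hT : ∀ p₁ p₂, x • p₁ + y • p₂ ∈ T := fun p₁ p₂ =>
    Submodule.add_mem_sup ⟨p₁, rfl⟩ ⟨p₂, rfl⟩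
  have hspan : (⊤ : Submodule k (LinearMap.ker f)) ≤
      T.comap ((LinearMap.ker f).subtype.restrictScalars k) := by
    rw [← B'.span_eq, Submodule.span_le, hB']
    rintro _ ⟨i | i, rfl⟩
    · change c i ∈ T
      obtain ⟨_ | i, hi⟩ := i
      · have := hT 0 (e 0)
        rwa [smul_zero, zero_add] at this
      · exact hT _ _
    · change x • c i ∈ T
      have := hT (c i) 0
      rwa [smul_zero, add_zero] at this
  intro p hp
  obtain ⟨_, ⟨p₁, rfl⟩, _, ⟨p₂, rfl⟩, e⟩ := Submodule.mem_sup.1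
    (hspan (Submodule.mem_top : (⟨p, hp⟩ : LinearMap.ker f) ∈ ⊤))
  exact ⟨p₁, p₂, e.symm⟩

end IsKleinPair

end Syzygies

section Cosyzygies

variable {k : Type*} [Field k] {A : Type u} [Ring A] [Algebra k A]
  {N : Type u} [AddCommGroup N] [Module A N] {x y : A}

theorem IsKleinPair.exists_injectiveHull (h : IsKleinPair k x y) {n : ℕ}
    (hN : HasCozigzagBasis k x y n N) :
    ∃ f : N →ₗ[A] (Fin (n + 1) → A), IsInjectiveHull f ∧
      HasCozigzagBasis k x y (n + 1) ((Fin (n + 1) → A) ⧸ LinearMap.range f) := by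
  obtain ⟨_, _, B, hB⟩ := hN
  have hfin : Module.Finite k A := Module.finite_of_finrank_eq_succ h.finrank_eq
  have hinj : Module.Injective A A := ⟨fun X Y _ _ _ _ f hf g => h.exists_extension f hf g⟩
  choose r hr using fun j : Fin (n + 1) => h.exists_frobenius (B.coord (Sum.inr j))
  let f : N →ₗ[A] (Fin (n + 1) → A) := LinearMap.pi r
  have hf : ∀ m j, f m j = B.coord (Sum.inr j) (x • y • m) • (1 : A) +
      B.coord (Sum.inr j) (y • m) • x + B.coord (Sum.inr j) (x • m) • y +
      B.coord (Sum.inr j) m • (x * y) := fun m j => hr j m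
  let e := stdVec A (n + 1)
  have hinl : ∀ i : Fin n, f (B (Sum.inl i)) = x • e i + y • e (i + 1) := fun i => by
    ext j
    rw [hf, hB.x_inl, hB.y_inl, hB.x_inr]
    simp [e, stdVec, Finsupp.single_apply, Fin.ext_iff, eq_comm]
  have hinr : ∀ i : Fin (n + 1), f (B (Sum.inr i)) = x • y • e i := fun i => by
    ext j
    rw [hf, hB.x_inr, hB.y_inr]
    simp [e, stdVec, Finsupp.single_apply, Fin.ext_iff, eq_comm]
  have hfi : Function.Injective f := by
    rw [← LinearMap.ker_eq_bot, eq_bot_iff]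
    intro m hm
    have h1 : ∀ j, B.coord (Sum.inr j) (y • m) = 0 ∧ B.coord (Sum.inr j) m = 0 := fun j => by
      have := congrFun (LinearMap.mem_ker.1 hm) j
      rw [hf] at this
      obtain ⟨_, h1, _, h2⟩ := h.coeff_eq_zero this
      exact ⟨h1, h2⟩
    have h2 : ∀ i : Fin n, B.coord (Sum.inl i) m = 0 := fun i => by
      rw [← (h1 i.castSucc).1]
      refine LinearMap.congr_fun (f := B.coord (Sum.inl i))
        (g := B.coord (Sum.inr i.castSucc) ∘ₗ Algebra.lsmul k k N y) (B.ext ?_) m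
      rintro (j | j)
      · simp [hB.y_inl, Finsupp.single_apply]
      · simp [hB.y_inr]
    rw [Submodule.mem_bot, ← B.forall_coord_eq_zero_iff]
    rintro (i | i)
    · exact h2 i
    · exact (h1 i).2
  have hess : ∀ K : Submodule A (Fin (n + 1) → A), K ⊓ LinearMap.range f = ⊥ → K = ⊥ := by
    intro K hK
    rw [eq_bot_iff]
    intro p hp
    by_contra hne
    obtain ⟨a, ha, q, hq⟩ := h.exists_smul_ne_zero (p := p) hne
    refine ha ((Submodule.mem_bot A).1 (hK ▸ ⟨K.smul_mem a hp, ?_⟩))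
    choose c hc using fun j => h.exists_mul_eq (q j)
    refine ⟨∑ i, c i • B (Sum.inr i), ?_⟩
    rw [hq, map_sum]
    have : ∀ i, f (c i • B (Sum.inr i)) = c i • x • y • e i := fun i => by
      rw [← hinr]
      exact (f.restrictScalars k).map_smul _ _
    ext j
    simp only [this, Finset.sum_apply, Pi.smul_apply, smul_eq_mul, hc, e, stdVec,
      ← Fin.ext_iff]
    simp
  refine ⟨f, ⟨inferInstance, hfi, hess⟩, inferInstance, inferInstance, ?_⟩
  let t : ℕ → (Fin (n + 1) → A) ⧸ LinearMap.range f := fun i => (LinearMap.range f).mkQ (e i)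
  have hmk : ∀ p ∈ LinearMap.range f, (LinearMap.range f).mkQ p = 0 := fun p hp => by
    simpa using hp
  have hrel : ∀ i < n, y • t (i + 1) = x • t i := fun i hi => by
    have h1 := hmk _ ⟨_, hinl ⟨i, hi⟩⟩
    rw [map_add, map_smul, map_smul] at h1
    calc y • t (i + 1) = y • t (i + 1) + (x • t i + x • t i) := by rw [h.add_self, add_zero]
      _ = (x • t i + y • t (i + 1)) + x • t i := by abel
      _ = x • t i := by rw [show x • t i + y • t (i + 1) = 0 from h1, zero_add]
  have hsoc : ∀ i, x • y • t i = 0 := fun i => by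
    by_cases hi : i < n + 1
    · have h1 := hmk _ ⟨_, hinr ⟨i, hi⟩⟩
      rwa [map_smul, map_smul] at h1
    · rw [show t i = 0 by
        change (LinearMap.range f).mkQ (stdVec A (n + 1) i) = 0
        rw [stdVec_eq_zero (by omega), map_zero], smul_zero, smul_zero]
  let b : Fin (n + 1) ⊕ Fin (n + 1 + 1) → (Fin (n + 1) → A) ⧸ LinearMap.range f :=
    Sum.elim (fun i => t i) (Fin.cases (y • t 0) fun i => x • t i)
  have hb0 : b (Sum.inr 0) = y • t 0 := rfl
  have hbs : ∀ i : Fin (n + 1), b (Sum.inr i.succ) = x • t i := fun i => rfl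
  have hyl : ∀ i, y • b (Sum.inl i) = b (Sum.inr i.castSucc) := fun i => by
    obtain ⟨_ | i, hi⟩ := i
    · rfl
    · exact hrel i (by omega)
  have hxl : ∀ i, x • b (Sum.inl i) = b (Sum.inr i.succ) := fun i => rfl
  have hyr : ∀ i, y • b (Sum.inr i) = 0 := fun i => by
    induction i using Fin.cases with
    | zero => rw [hb0, h.yy_smul]
    | succ i => rw [hbs, h.yx_smul, hsoc]
  have hxr : ∀ i, x • b (Sum.inr i) = 0 := fun i => by
    induction i using Fin.cases with
    | zero => rw [hb0, hsoc]
    | succ i => rw [hbs, h.xx_smul]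
  have hspan : (⊤ : Submodule k _) ≤ Submodule.span k (Set.range b) := by
    have hx : ∀ m ∈ Submodule.span k (Set.range b), x • m ∈ Submodule.span k (Set.range b) := by
      refine fun m hm => (Submodule.span_le (p := (Submodule.span k (Set.range b)).comap
        (Algebra.lsmul k k _ x))).2 ?_ hm
      rintro _ ⟨i | i, rfl⟩
      · exact Submodule.subset_span ⟨_, (hxl i).symm⟩
      · change x • b (Sum.inr i) ∈ Submodule.span k (Set.range b)
        rw [hxr]
        exact Submodule.zero_mem _
    have hy : ∀ m ∈ Submodule.span k (Set.range b), y • m ∈ Submodule.span k (Set.range b) := by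
      refine fun m hm => (Submodule.span_le (p := (Submodule.span k (Set.range b)).comap
        (Algebra.lsmul k k _ y))).2 ?_ hm
      rintro _ ⟨i | i, rfl⟩
      · exact Submodule.subset_span ⟨_, (hyl i).symm⟩
      · change y • b (Sum.inr i) ∈ Submodule.span k (Set.range b)
        rw [hyr]
        exact Submodule.zero_mem _
    intro m _
    obtain ⟨p, rfl⟩ := (LinearMap.range f).mkQ_surjective m
    rw [sum_smul_stdVec p, map_sum]
    refine Submodule.sum_mem _ fun i _ => ?_
    rw [map_smul]
    exact h.smul_mem_of_smul_mem hx hy _ (Submodule.subset_span ⟨Sum.inl i, rfl⟩)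
  have hrank : Fintype.card (Fin (n + 1) ⊕ Fin (n + 1 + 1)) =
      Module.finrank k ((Fin (n + 1) → A) ⧸ LinearMap.range f) := by
    have h1 := ((LinearMap.range f).mkQ.restrictScalars k).finrank_range_add_finrank_ker
    rw [(LinearMap.range_eq_top (f := (LinearMap.range f).mkQ.restrictScalars k)).2
      (LinearMap.range f).mkQ_surjective, finrank_top, h.finrank_pi] at h1
    have h2 : LinearMap.ker ((LinearMap.range f).mkQ.restrictScalars k) =
        LinearMap.range (f.restrictScalars k) := by
      ext p
      simp
    rw [h2, LinearMap.finrank_range_of_inj (f := f.restrictScalars k) hfi,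
      Module.finrank_eq_card_basis B] at h1
    simp only [Fintype.card_sum, Fintype.card_fin] at h1 ⊢
    omega
  have hB' := coe_basisOfTopLeSpanOfCardEqFinrank b hspan hrank
  exact ⟨basisOfTopLeSpanOfCardEqFinrank b hspan hrank, by
    constructor <;> rw [hB'] <;> assumption⟩

end Cosyzygies

section Iterated

variable {k : Type u} [Field k] {A : Type u} [Ring A] [Algebra k A] {x y : A}

/-- `X` is a one-dimensional module on which `x` and `y` act by zero. -/
def IsTrivialModule (k : Type u) [Field k] {A : Type u} [Ring A] [Algebra k A] (x y : A)
    (X : Type u) [AddCommGroup X] [Module A X] : Prop :=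
  ∃ (_ : Module k X) (_ : IsScalarTower k A X), Nonempty (Module.Basis Unit k X) ∧
    (∀ m : X, x • m = 0) ∧ ∀ m : X, y • m = 0

theorem IsTrivialModule.hasZigzagBasis {X : Type u} [AddCommGroup X] [Module A X]
    (hX : IsTrivialModule k x y X) : HasZigzagBasis k x y 0 X := by
  obtain ⟨_, _, ⟨B⟩, hx, hy⟩ := hX
  refine ⟨inferInstance, inferInstance, B.reindex
    ((Equiv.ofUnique Unit (Fin 1)).trans (Equiv.sumEmpty _ _).symm),
    fun i => if i = 0 then B () else 0, ⟨hy _, fun i => (hx _).trans (hy _).symm,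
    fun i hi => if_neg (by omega)⟩, fun i => ?_, fun i => i.elim0⟩
  obtain rfl := Fin.fin_one_eq_zero i
  simp

theorem IsTrivialModule.hasCozigzagBasis {X : Type u} [AddCommGroup X] [Module A X]
    (hX : IsTrivialModule k x y X) : HasCozigzagBasis k x y 0 X := by
  obtain ⟨_, _, ⟨B⟩, hx, hy⟩ := hX
  exact ⟨inferInstance, inferInstance, B.reindex
    ((Equiv.ofUnique Unit (Fin 1)).trans (Equiv.emptySum _ _).symm),
    fun i => i.elim0, fun i => i.elim0, fun i => hy _, fun i => hx _⟩

namespace IsKleinPair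

variable (h : IsKleinPair k x y)
include h

theorem hasZigzagBasis_of_isNthSyzygy {X : ModuleCat.{u} A} (hX : IsTrivialModule k x y X) {n : ℕ}
    {N : ModuleCat.{u} A} (hN : IsNthSyzygy X n N) : HasZigzagBasis k x y n N := by
  induction n generalizing N with
  | zero =>
    obtain ⟨e⟩ := hN
    exact hX.hasZigzagBasis.of_equiv e
  | succ n ih =>
    obtain ⟨Z, hZ, P, f, hf, ⟨e⟩⟩ := hN
    obtain ⟨f', hf', h'⟩ := h.exists_projectiveCover (ih hZ)
    obtain ⟨e'⟩ := hf'.ker_equiv hf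
    exact h'.of_equiv (e'.trans e.symm)

theorem exists_isNthSyzygy {X : ModuleCat.{u} A} (hX : IsTrivialModule k x y X) (n : ℕ) :
    ∃ N : ModuleCat.{u} A, IsNthSyzygy X n N := by
  induction n with
  | zero => exact ⟨X, ⟨LinearEquiv.refl A X⟩⟩
  | succ n ih =>
    obtain ⟨Z, hZ⟩ := ih
    obtain ⟨f, hf, _⟩ := h.exists_projectiveCover (h.hasZigzagBasis_of_isNthSyzygy hX hZ)
    exact ⟨ModuleCat.of A (LinearMap.ker f), Z, hZ, ModuleCat.of A (Fin (n + 1) → A), f, hf,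
      ⟨LinearEquiv.refl A _⟩⟩

theorem hasCozigzagBasis_of_isNthCosyzygy {X : ModuleCat.{u} A} (hX : IsTrivialModule k x y X)
    {n : ℕ} {N : ModuleCat.{u} A} (hN : IsNthCosyzygy X n N) : HasCozigzagBasis k x y n N := by
  induction n generalizing N with
  | zero =>
    obtain ⟨e⟩ := hN
    exact hX.hasCozigzagBasis.of_equiv e
  | succ n ih =>
    obtain ⟨Z, hZ, P, f, hf, ⟨e⟩⟩ := hN
    obtain ⟨f', hf', h'⟩ := h.exists_injectiveHull (ih hZ)
    obtain ⟨e'⟩ := hf'.coker_equiv hf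
    exact h'.of_equiv (e'.trans e.symm)

theorem exists_isNthCosyzygy {X : ModuleCat.{u} A} (hX : IsTrivialModule k x y X) (n : ℕ) :
    ∃ N : ModuleCat.{u} A, IsNthCosyzygy X n N := by
  induction n with
  | zero => exact ⟨X, ⟨LinearEquiv.refl A X⟩⟩
  | succ n ih =>
    obtain ⟨Z, hZ⟩ := ih
    obtain ⟨f, hf, _⟩ := h.exists_injectiveHull (h.hasCozigzagBasis_of_isNthCosyzygy hX hZ)
    exact ⟨ModuleCat.of A ((Fin (n + 1) → A) ⧸ LinearMap.range f), Z, hZ,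
      ModuleCat.of A (Fin (n + 1) → A), f, hf, ⟨LinearEquiv.refl A _⟩⟩

end IsKleinPair

end Iterated

section Splitting

variable {k : Type*} [Field k] {A : Type*} [Ring A] [Algebra k A]
  {N : Type*} [AddCommGroup N] [Module A N] [Module k N] [IsScalarTower k A N]
  {M : Type*} [AddCommGroup M] [Module A M] [Module k M] [IsScalarTower k A M] {x y : A}

theorem IsIsoToSubmodule.of_injective (F : N →ₗ[A] M) (hF : Function.Injective F) :
    IsIsoToSubmodule A N M :=
  ⟨LinearMap.range F, ⟨LinearEquiv.ofInjective F hF⟩⟩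

theorem IsIsoToQuotient.of_surjective (F : M →ₗ[A] N) (hF : Function.Surjective F) :
    IsIsoToQuotient A N M :=
  ⟨LinearMap.ker F, ⟨(F.quotKerEquivOfSurjective hF).symm⟩⟩

theorem exists_dual_family {n : ℕ} {φ : Fin n → Module.Dual k M} (hφ : LinearIndependent k φ)
    (i : Fin n) : ∃ m, ∀ j, φ j m = if j = i then 1 else 0 := by
  have hs : LinearMap.range (LinearMap.pi φ) = ⊤ := by
    by_contra hne
    obtain ⟨f, hf, hz⟩ := Submodule.exists_dual_map_eq_bot_of_lt_top (lt_top_iff_ne_top.2 hne)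
      inferInstance
    rw [Fintype.linearIndependent_iff] at hφ
    have hfe : ∀ c : Fin n → k, f c = ∑ j, f (Pi.single j 1) * c j := fun c => by
      conv_lhs => rw [pi_eq_sum_univ' c, map_sum]
      refine Finset.sum_congr rfl fun j _ => ?_
      rw [map_smul, smul_eq_mul, mul_comm]
    refine hf (LinearMap.ext fun c => ?_)
    have h0 := hφ (fun j => f (Pi.single j 1)) (LinearMap.ext fun m => by
      have : f (LinearMap.pi φ m) = 0 := by
        rw [← Submodule.mem_bot k, ← hz]
        exact ⟨_, ⟨m, rfl⟩, rfl⟩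
      rw [hfe] at this
      simpa [LinearMap.sum_apply] using this)
    rw [hfe]
    simp [h0]
  obtain ⟨m, hm⟩ := LinearMap.range_eq_top.1 hs (Pi.single i 1)
  exact ⟨m, fun j => by rw [← LinearMap.pi_apply φ m j, hm, Pi.single_apply]⟩

theorem zigzag_pairing {p : ℕ} {a : ℕ → M} (ha : IsModuleChain k x y (p + 1) a)
    {s : ℕ → Module.Dual k M} (hs : ∀ i < p, ∀ m, s i (y • m) = s (i + 1) (x • m))
    (h1 : s 0 (x • a 0) = 1) {i j : ℕ} (hj : j ≤ p) :
    s j (x • a i) = if j = i then 1 else 0 := by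
  have hxy : ∀ i, x • a i = y • a (i + 1) := ha.map_succ
  induction j generalizing i with
  | zero =>
    obtain _ | i := i
    · simpa using h1
    · rw [if_neg (by omega)]
      have : ∀ t ≤ p, s 0 (x • a (i + 1)) = s t (x • a (i + 1 + t)) := fun t ht => by
        induction t with
        | zero => rfl
        | succ t ih => rw [ih (by omega), hxy, hs t (by omega)]; rfl
      rw [this p le_rfl, show x • a (i + 1 + p) = 0 from ha.map_last (by omega), map_zero]
  | succ j ih =>
    rw [← hs j (by omega)]
    obtain _ | i := i
    · rw [show y • a 0 = 0 from ha.map_zero, map_zero, if_neg (by omega)]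
    · rw [← hxy, ih (by omega)]
      simp

theorem cozigzag_pairing {n : ℕ} {s : ℕ → Module.Dual k M} (hs : IsModuleCochain k x y n s)
    {a : ℕ → M} (ha : ∀ i, i + 1 < n → x • a i = y • a (i + 1)) (h1 : s 0 (y • a 0) = 1)
    {i j : ℕ} (hi : i < n) : s j (y • a i) = if j = i then 1 else 0 := by
  have hs0 : ∀ m, s 0 (x • m) = 0 := fun m => LinearMap.congr_fun hs.map_zero m
  have hss : ∀ i m, s i (y • m) = s (i + 1) (x • m) := fun i m =>
    LinearMap.congr_fun (hs.map_succ i) m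
  induction i generalizing j with
  | zero =>
    obtain _ | j := j
    · simpa using h1
    · rw [if_neg (by omega)]
      have : ∀ t < n, s (j + 1) (y • a 0) = s (j + 1 + t) (y • a t) := fun t ht => by
        induction t with
        | zero => rfl
        | succ t ih => rw [ih (by omega), hss, ha t ht]; rfl
      rw [this (n - 1) (by omega), hss, hs.eq_zero _ (by omega), LinearMap.zero_apply]
  | succ i ih =>
    rw [← ha i hi]
    obtain _ | j := j
    · rw [hs0, if_neg (by omega)]
    · rw [← hss, ih (by omega)]
      simp

namespace IsKleinPair

variable (h : IsKleinPair k x y)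
include h

/-- Functionals compatible with the pencil give maps to a zigzag module. -/
theorem exists_zigzag_retraction (hM : ∀ m : M, x • y • m = 0) {p : ℕ}
    {B : Module.Basis (Fin (p + 1 + 1) ⊕ Fin (p + 1)) k N} {a : ℕ → N}
    (hB : IsZigzagBasis x y (p + 1) B a) {s : ℕ → Module.Dual k M}
    (hs : ∀ i < p, ∀ m, s i (y • m) = s (i + 1) (x • m)) :
    ∃ F : M →ₗ[A] N, ∀ m, F (x • m) = ∑ j : Fin (p + 1), s j (x • m) • B (Sum.inr j) := by
  let f : M →ₗ[k] N :=
    ∑ i : Fin (p + 1), (s i ∘ₗ Algebra.lsmul k k M x).smulRight (a i) +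
      (s p ∘ₗ Algebra.lsmul k k M y).smulRight (a (p + 1)) +
      ∑ i : Fin (p + 1), (s i).smulRight (x • a i)
  have hf : ∀ m, f m = ∑ i : Fin (p + 1), s i (x • m) • a i + s p (y • m) • a (p + 1) +
      ∑ i : Fin (p + 1), s i m • x • a i := fun m => by
    simp [f, LinearMap.sum_apply]
  have hxy : ∀ i, x • a i = y • a (i + 1) := hB.chain.map_succ
  have hyx : ∀ i, y • x • a i = 0 := fun i => by rw [hxy, h.yy_smul]
  have hy0 : y • a 0 = 0 := hB.chain.map_zero
  have hxn : x • a (p + 1) = 0 := hB.chain.map_last le_rfl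
  have hfx : ∀ m, f (x • m) = ∑ i : Fin (p + 1), s i (x • m) • x • a i := fun m => by
    simp only [hf, h.xx_smul, h.yx_smul, hM, map_zero, zero_smul, Finset.sum_const_zero, zero_add]
  have hfy : ∀ m, f (y • m) = ∑ i : Fin (p + 1), s i (y • m) • x • a i := fun m => by
    simp only [hf, h.yy_smul, hM, map_zero, zero_smul, Finset.sum_const_zero, zero_add]
  obtain ⟨F, hF⟩ := h.exists_linearMap f (fun m => by
    rw [hfx, hf]
    simp only [smul_add, Finset.smul_sum, smul_comm x (_ : k), h.xx_smul, hxn, smul_zero,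
      Finset.sum_const_zero, add_zero]) (fun m => by
    rw [hfy, hf]
    simp only [smul_add, Finset.smul_sum, smul_comm y (_ : k), hyx, smul_zero,
      Finset.sum_const_zero, add_zero]
    rw [Fin.sum_univ_castSucc, Fin.sum_univ_succ]
    simp only [Fin.val_zero, hy0, smul_zero, zero_add, Fin.val_succ, Fin.val_castSucc, Fin.val_last,
      ← hxy]
    congr 1
    exact Finset.sum_congr rfl fun i _ => by rw [hs i i.2])
  exact ⟨F, fun m => by rw [hF, hfx]; simp only [hB.inr]⟩

end IsKleinPair

/-- The socle coordinates of a cozigzag module form a chain of functionals. -/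
theorem IsCozigzagBasis.exists_cochain {n : ℕ} {B : Module.Basis (Fin n ⊕ Fin (n + 1)) k N}
    (hB : IsCozigzagBasis x y n B) :
    ∃ s : ℕ → Module.Dual k N, IsModuleCochain k x y n s ∧
      ∀ i : Fin n, s i (y • B (Sum.inl i)) = 1 := by
  let s : ℕ → Module.Dual k N := fun i =>
    if hi : i < n + 1 then B.coord (Sum.inr ⟨i, hi⟩) else 0
  have hs : ∀ i (j : Fin (n + 1)), s i (B (Sum.inr j)) = if (j : ℕ) = i then 1 else 0 := by
    intro i j
    by_cases hi : i < n + 1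
    · rw [show s i = B.coord (Sum.inr ⟨i, hi⟩) from dif_pos hi]
      simp [Finsupp.single_apply, Fin.ext_iff]
    · have : (j : ℕ) ≠ i := by omega
      rw [show s i = 0 from dif_neg hi, LinearMap.zero_apply, if_neg this]
  refine ⟨s, ⟨B.ext ?_, fun i => B.ext ?_, fun i hi => dif_neg (by omega)⟩, fun i => ?_⟩
  · rintro (j | j)
    · change s 0 (x • _) = 0
      rw [hB.x_inl, hs]
      simp
    · change s 0 (x • _) = 0
      rw [hB.x_inr, map_zero]
  · rintro (j | j)
    · change s i (y • _) = s (i + 1) (x • _)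
      rw [hB.x_inl, hB.y_inl, hs, hs]
      simp
    · change s i (y • _) = s (i + 1) (x • _)
      rw [hB.x_inr, hB.y_inr, map_zero, map_zero]
  · rw [hB.y_inl, hs]
    simp

end Splitting

section Main

variable {k : Type u} [Field k] {A : Type u} [Ring A] [Algebra k A] {x y : A}
  {M : Type v} [AddCommGroup M] [Module A M]

theorem IsKleinPair.isIsoToSummand_of_isLeast_syzygy (h : IsKleinPair k x y) {X : ModuleCat.{u} A}
    (hX : IsTrivialModule k x y X) (hM : IsProjectiveFree A M) {l : ℕ}
    (hl : IsLeast {n : ℕ | 0 < n ∧ ∃ N : ModuleCat.{u} A,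
      IsNthSyzygy X n N ∧ IsIsoToSubmodule A N M} l)
    {N : ModuleCat.{u} A} (hN : IsNthSyzygy X l N) : IsIsoToSummand A N M := by
  let _ := Module.compHom M (algebraMap k A)
  have := isScalarTower_compHom k A M
  have hM' : ∀ m : M, x • y • m = 0 := h.smul_eq_zero_of_isProjectiveFree hM
  obtain ⟨⟨hl0, N₀, hN₀, S, ⟨e⟩⟩, hmin⟩ := hl
  obtain ⟨p, rfl⟩ : ∃ p, l = p + 1 := ⟨l - 1, by omega⟩
  obtain ⟨_, _, B₀, a₀, hB₀⟩ := h.hasZigzagBasis_of_isNthSyzygy hX hN₀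
  let F₀ : N₀ →ₗ[A] M := S.subtype ∘ₗ e.toLinearMap
  have hF₀ : Function.Injective F₀ := S.injective_subtype.comp e.injective
  let a : ℕ → M := fun i => F₀ (a₀ i)
  have ha : IsModuleChain k x y (p + 1) a := by
    refine ⟨?_, fun i => ?_, fun i hi => ?_⟩
    · change y • F₀ (a₀ 0) = 0
      rw [← map_smul F₀, show y • a₀ 0 = 0 from hB₀.chain.map_zero, map_zero]
    · change x • F₀ (a₀ i) = y • F₀ (a₀ (i + 1))
      rw [← map_smul F₀, ← map_smul F₀, show x • a₀ i = y • a₀ (i + 1) from hB₀.chain.map_succ i]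
    · change F₀ (a₀ i) = 0
      rw [hB₀.chain.eq_zero i hi, map_zero]
  have ha0 : x • a 0 ≠ 0 := by
    have : x • a 0 = F₀ (B₀ (Sum.inr 0)) := by rw [hB₀.inr, map_smul]; rfl
    rw [this]
    exact (map_ne_zero_iff F₀ hF₀).2 (B₀.ne_zero _)
  have hnot : x • a 0 ∉ pencilReach (Algebra.lsmul k k M x) (Algebra.lsmul k k M y) p := by
    intro hr
    obtain ⟨v, hv0, hvs, hvz⟩ := exists_of_mem_pencilReach hr
    have hc : IsModuleChain k x y p (fun i => Nat.casesOn (motive := fun _ => M) i (a 0) v) := by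
      refine ⟨ha.map_zero, fun i => ?_, fun i hi => ?_⟩
      · cases i with
        | zero => exact hv0
        | succ i => exact hvs i
      · obtain ⟨i, rfl⟩ : ∃ j, i = j + 1 := ⟨i - 1, by omega⟩
        exact hvz i (by omega)
    obtain ⟨m, hm, hmp, a', ha', hli⟩ := hc.exists_linearIndependent ha0
    obtain ⟨N', hN'⟩ := h.exists_isNthSyzygy hX m
    obtain ⟨_, _, B', b', hB'⟩ := h.hasZigzagBasis_of_isNthSyzygy hX hN'
    obtain ⟨F, hF⟩ := h.exists_zigzag_lift hB' ha'
    have hFi : Function.Injective F := h.injective_of_zigzag hm hB' F (by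
      simpa [hF] using hli)
    have := hmin ⟨hm, N', hN', IsIsoToSubmodule.of_injective F hFi⟩
    omega
  obtain ⟨s, hs0, hs⟩ := exists_functionals_of_notMem_pencilReach hnot
  have hs' : ∀ i < p, ∀ m, s i (y • m) = s (i + 1) (x • m) := fun i hi m =>
    LinearMap.congr_fun (hs i hi) m
  obtain ⟨_, _, B, b, hB⟩ := h.hasZigzagBasis_of_isNthSyzygy hX hN
  obtain ⟨F, hF⟩ := h.exists_zigzag_lift hB ha
  obtain ⟨G, hG⟩ := h.exists_zigzag_retraction hM' hB hs'
  have hGF : Function.Injective (G ∘ₗ F) := by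
    refine h.injective_of_zigzag hl0 hB _ ?_
    convert B.linearIndependent.comp Sum.inr Sum.inr_injective using 1
    ext i
    rw [LinearMap.comp_apply, map_smul, hF, hG]
    simp only [fun j : Fin (p + 1) => zigzag_pairing ha hs' hs0 (i := i)
      (Nat.le_of_lt_succ j.2)]
    simp [← Fin.ext_iff]
  have : Module.Finite k N := Module.Finite.of_basis B
  obtain ⟨hc, e⟩ := isIsoToSummand_of_bijective F G
    ⟨hGF, (LinearMap.injective_iff_surjective (f := (G ∘ₗ F).restrictScalars k)).1 hGF⟩
  exact ⟨_, _, hc, e⟩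

theorem IsKleinPair.isIsoToSummand_of_isLeast_cosyzygy (h : IsKleinPair k x y)
    {X : ModuleCat.{u} A} (hX : IsTrivialModule k x y X) (hM : IsProjectiveFree A M) {l : ℕ}
    (hl : IsLeast {n : ℕ | 0 < n ∧ ∃ N : ModuleCat.{u} A,
      IsNthCosyzygy X n N ∧ IsIsoToQuotient A N M} l)
    {N : ModuleCat.{u} A} (hN : IsNthCosyzygy X l N) : IsIsoToSummand A N M := by
  let _ := Module.compHom M (algebraMap k A)
  have := isScalarTower_compHom k A M
  have hM' : ∀ m : M, x • y • m = 0 := h.smul_eq_zero_of_isProjectiveFree hM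
  obtain ⟨⟨hl0, N₀, hN₀, S, ⟨e⟩⟩, hmin⟩ := hl
  obtain ⟨p, rfl⟩ : ∃ p, l = p + 1 := ⟨l - 1, by omega⟩
  obtain ⟨_, _, B₀, hB₀⟩ := h.hasCozigzagBasis_of_isNthCosyzygy hX hN₀
  obtain ⟨s₀, hs₀, hs₀1⟩ := hB₀.exists_cochain
  let F₀ : M →ₗ[A] N₀ := e.symm.toLinearMap ∘ₗ S.mkQ
  have hF₀ : Function.Surjective F₀ := e.symm.surjective.comp S.mkQ_surjective
  let s : ℕ → Module.Dual k M := fun i => s₀ i ∘ₗ F₀.restrictScalars k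
  have hs : IsModuleCochain k x y (p + 1) s := by
    refine ⟨LinearMap.ext fun m => ?_, fun i => LinearMap.ext fun m => ?_, fun i hi => ?_⟩
    · change s₀ 0 (F₀ (x • m)) = 0
      rw [map_smul]
      exact LinearMap.congr_fun hs₀.map_zero _
    · change s₀ i (F₀ (y • m)) = s₀ (i + 1) (F₀ (x • m))
      rw [map_smul F₀, map_smul F₀]
      exact LinearMap.congr_fun (hs₀.map_succ i) _
    · change s₀ i ∘ₗ F₀.restrictScalars k = 0
      rw [hs₀.eq_zero i hi, LinearMap.zero_comp]
  obtain ⟨m₀, hm₀⟩ := hF₀ (B₀ (Sum.inl 0))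
  have hs0 : s 0 ∘ₗ Algebra.lsmul k k M y ≠ 0 := fun e => by
    have h1 : s₀ 0 (F₀ (y • m₀)) = 0 := LinearMap.congr_fun e m₀
    rw [map_smul, hm₀] at h1
    exact one_ne_zero ((hs₀1 0).symm.trans h1)
  have hex : ∃ v ∈ pencilDomain (Algebra.lsmul k k M x) (Algebra.lsmul k k M y) p,
      s 0 (y • v) ≠ 0 := by
    by_contra! hc
    obtain ⟨φ, hφ0, hφs, hφz⟩ := exists_functionals_of_forall_mem_pencilDomain
      (r := s 0 ∘ₗ Algebra.lsmul k k M y) hc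
    have hc : IsModuleCochain k x y p 
        (fun i => Nat.casesOn (motive := fun _ => Module.Dual k M) i (s 0) φ) := by
      refine ⟨hs.map_zero, fun i => ?_, fun i hi => ?_⟩
      · cases i with
        | zero => exact hφ0
        | succ i => exact hφs i
      · obtain ⟨i, rfl⟩ : ∃ j, i = j + 1 := ⟨i - 1, by omega⟩
        exact hφz i (by omega)
    obtain ⟨m, hm, hmp, s', hs', hli⟩ := hc.exists_linearIndependent hs0
    obtain ⟨N', hN'⟩ := h.exists_isNthCosyzygy hX m
    obtain ⟨_, _, B', hB'⟩ := h.hasCozigzagBasis_of_isNthCosyzygy hX hN'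
    obtain ⟨F, hF⟩ := h.exists_cozigzag_lift hB' hs'
    have hFs : Function.Surjective F := hB'.surjective hm F fun i => by
      obtain ⟨m, hm⟩ := exists_dual_family hli i
      have hm' : ∀ j : Fin _, s' j (y • m) = if j = i then 1 else 0 := hm
      exact ⟨m, fun j => s' j m, by rw [hF]; simp [hm']⟩
    have := hmin ⟨hm, N', hN', IsIsoToQuotient.of_surjective F hFs⟩
    omega
  obtain ⟨v, hv, hne⟩ := hex
  obtain ⟨a, ha0, ha⟩ := exists_of_mem_pencilDomain
    (Submodule.smul_mem _ (s 0 (y • v))⁻¹ hv)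
  have ha' : ∀ i, i + 1 < p + 1 → x • a i = y • a (i + 1) := fun i hi => ha i (by omega)
  have h1 : s 0 (y • a 0) = 1 := by
    rw [ha0, smul_comm, map_smul, smul_eq_mul, inv_mul_cancel₀ hne]
  obtain ⟨_, _, B, hB⟩ := h.hasCozigzagBasis_of_isNthCosyzygy hX hN
  obtain ⟨F, hF⟩ := h.exists_cozigzag_desc hM' hB ha'
  obtain ⟨G, hG⟩ := h.exists_cozigzag_lift hB hs
  have hGF : Function.Surjective (G ∘ₗ F) := hB.surjective hl0 _ fun i => by
    refine ⟨B (Sum.inl i), fun j => s j (a i), ?_⟩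
    rw [LinearMap.comp_apply, hF, hG]
    simp only [cozigzag_pairing hs ha' h1 i.2]
    simp [← Fin.ext_iff]
  have : Module.Finite k N := Module.Finite.of_basis B
  obtain ⟨hc, e⟩ := isIsoToSummand_of_bijective F G
    ⟨(LinearMap.injective_iff_surjective (f := (G ∘ₗ F).restrictScalars k)).2 hGF, hGF⟩
  exact ⟨_, _, hc, e⟩

end Main

section KleinFour

theorem isKleinPair_monoidAlgebra (k : Type*) [Field k] [CharP k 2] {G : Type*} [Group G]
    [IsKleinFour G] {g t : G} (hg : g ≠ 1) (ht : t ≠ 1) (hgt : g ≠ t) :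
    IsKleinPair k (MonoidAlgebra.of k G g - 1) (MonoidAlgebra.of k G t - 1) := by
  classical
  have := IsKleinFour.instFinite (G := G)
  have := Fintype.ofFinite G
  have two : (1 : MonoidAlgebra k G) + 1 = 0 := by
    rw [← map_one (algebraMap k (MonoidAlgebra k G)), ← map_add, CharTwo.add_self_eq_zero, map_zero]
  have hsq : ∀ g : G, (MonoidAlgebra.of k G g - 1) * (MonoidAlgebra.of k G g - 1) = 0 := fun g => by
    have e : MonoidAlgebra.of k G g * MonoidAlgebra.of k G g = 1 := by
      rw [← map_mul, IsKleinFour.mul_self, map_one]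
    calc _ = (1 + 1) - (1 + 1) * MonoidAlgebra.of k G g := by
          rw [sub_mul, mul_sub, e]; noncomm_ring
      _ = 0 := by rw [two, zero_mul, sub_zero]
  have hcomm : t * g = g * t := by
    have := IsKleinFour.isMulCommutative (G := G)
    exact mul_comm' t g
  refine ⟨two, hsq g, hsq t, ?_, ?_, fun a => ?_, ?_⟩
  · have : MonoidAlgebra.of k G t * MonoidAlgebra.of k G g =
        MonoidAlgebra.of k G g * MonoidAlgebra.of k G t := by
      rw [← map_mul, ← map_mul, hcomm]
    rw [sub_mul, mul_sub, this]
    noncomm_ring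
  · intro e
    have h1 : g * t ≠ 1 := fun e => hgt (by
      rw [← IsKleinFour.inv_eq_self t]; exact eq_inv_of_mul_eq_one_left e)
    have e1 : (MonoidAlgebra.of k G g - 1) * (MonoidAlgebra.of k G t - 1) =
        MonoidAlgebra.of k G (g * t) - MonoidAlgebra.of k G g - MonoidAlgebra.of k G t +
          MonoidAlgebra.of k G 1 := by
      rw [map_mul, map_one]; noncomm_ring
    rw [e1] at e
    have := congrArg (fun z => z.coeff 1) e
    simp [MonoidAlgebra.of_apply, h1, hg, ht] at this
  · have e : a = ∑ u : G, a.coeff u • MonoidAlgebra.of k G u := by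
      conv_lhs => rw [← (MonoidAlgebra.basis G k).sum_repr a]
      rfl
    have hne : g * t ∉ ({g, t, 1} : Finset G) := by
      have := mul_notMem_of_exponent_two (G := G) (by simp) hg ht hgt
      simpa using this
    refine ⟨a.coeff 1 + a.coeff g + a.coeff t + a.coeff (g * t), a.coeff g + a.coeff (g * t),
      a.coeff t + a.coeff (g * t), a.coeff (g * t), ?_⟩
    conv_lhs => rw [e]
    rw [← IsKleinFour.eq_finset_univ hg ht hgt, Finset.sum_insert hne,
      Finset.sum_insert (by simp [hg, hgt]), Finset.sum_insert (by simp [ht]),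
      Finset.sum_singleton, map_mul (MonoidAlgebra.of k G),
      map_one (MonoidAlgebra.of k G)]
    simp only [sub_mul, mul_sub, mul_one, one_mul, smul_sub, add_smul]
    abel
  · rw [Module.finrank_eq_nat_card_basis (MonoidAlgebra.basis G k), IsKleinFour.card_four]

theorem exists_ne_one_ne_one_ne (G : Type*) [Group G] [IsKleinFour G] :
    ∃ g t : G, g ≠ 1 ∧ t ≠ 1 ∧ g ≠ t := by
  classical
  have := IsKleinFour.instFinite (G := G)
  have := Fintype.ofFinite G
  have h4 : Fintype.card G = 4 := by rw [← Nat.card_eq_fintype_card, IsKleinFour.card_four]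
  obtain ⟨g, hg⟩ := Finset.exists_mem_notMem_of_card_lt_card (s := {(1 : G)}) (t := Finset.univ)
    (by rw [Finset.card_univ, h4]; simp)
  obtain ⟨t, ht⟩ := Finset.exists_mem_notMem_of_card_lt_card (s := {(1 : G), g})
    (t := Finset.univ) (by
      rw [Finset.card_univ, h4]; exact Finset.card_le_two.trans_lt (by norm_num))
  simp only [Finset.mem_univ, Finset.mem_singleton, Finset.mem_insert, not_or, true_and] at hg ht
  exact ⟨g, t, hg, ht.1, fun e => ht.2 e.symm⟩

theorem isTrivialModule_trivialModule (k : Type u) [Field k] (G : Type) [Group G] (g t : G) :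
    IsTrivialModule k (MonoidAlgebra.of k G g - 1) (MonoidAlgebra.of k G t - 1)
      (trivialModule k G) := by
  have hact : ∀ (g : G) (m : (Representation.trivial k G k).asModule),
      (MonoidAlgebra.of k G g - 1) • m = 0 := fun g m => by
    rw [sub_smul, one_smul, MonoidAlgebra.of_apply, Representation.single_smul, one_smul,
      Representation.isTrivial_def]
    exact sub_self m
  refine ⟨inferInstanceAs (Module k (Representation.trivial k G k).asModule),
    inferInstanceAs (IsScalarTower k (MonoidAlgebra k G) (Representation.trivial k G k).asModule),
    ⟨(Module.Basis.singleton Unit k).map (Representation.trivial k G k).asModuleEquiv.symm⟩,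
    hact g, hact t⟩

end KleinFour

theorem theorem6p1 (k : Type u) [Field k] [CharP k 2] (G : Type) [Group G] [IsKleinFour G]
    (M : Type v) [AddCommGroup M] [Module (MonoidAlgebra k G) M]
    (hM : IsProjectiveFree (MonoidAlgebra k G) M) :
    (∀ l : ℕ,
      IsLeast {n : ℕ | 0 < n ∧ ∃ N : ModuleCat.{u} (MonoidAlgebra k G),
        IsNthSyzygy (trivialModule k G) n N ∧ IsIsoToSubmodule (MonoidAlgebra k G) N M} l →
      ∀ N : ModuleCat.{u} (MonoidAlgebra k G), IsNthSyzygy (trivialModule k G) l N →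
        IsIsoToSummand (MonoidAlgebra k G) N M) ∧
    (∀ l : ℕ,
      IsLeast {n : ℕ | 0 < n ∧ ∃ N : ModuleCat.{u} (MonoidAlgebra k G),
        IsNthCosyzygy (trivialModule k G) n N ∧ IsIsoToQuotient (MonoidAlgebra k G) N M} l →
      ∀ N : ModuleCat.{u} (MonoidAlgebra k G), IsNthCosyzygy (trivialModule k G) l N →
        IsIsoToSummand (MonoidAlgebra k G) N M) := by
  obtain ⟨g, t, hg, ht, hgt⟩ := exists_ne_one_ne_one_ne G
  have h := isKleinPair_monoidAlgebra k hg ht hgt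
  have hX := isTrivialModule_trivialModule k G g t
  exact ⟨fun l hl N hN => h.isIsoToSummand_of_isLeast_syzygy hX hM hl hN,
    fun l hl N hN => h.isIsoToSummand_of_isLeast_cosyzygy hX hM hl hN⟩
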